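/- Consider an M/M/$\infty$ queue in a semi-Markovian random environment $\Gamma$ with finite state space $\{1,\dots,K\}$. The environment moves through its states according to an irreducible stochastic matrix $P$ with stationary distribution $\pi$ ($\pi P=\pi$); its sojourn times in state $k$ are independent copies of a positive random variable $T_k$ with $\mathbb{E}[T_k]<\infty$ and Laplace transform $\tau_k(s)=\mathbb{E}[e^{-sT_k}]$. While the environment is in state $k$, customers arrive at Poisson rate $\lambda_k\ge 0$ (with $\max_k\lambda_k>0$) and every server works at speed $\beta_k\ge 0$; service requests are i.i.d. exponential of rate $\mu>0$, independent of the arrivals and the environment. Put $\mu_k=\mu\beta_k$ and $\rho_k=\lambda_k/\mu_k$, where we assume that $\mu_k=0$ implies $\lambda_k=0$ (and set $\rho_k=0$ in that case). For a path $\gamma$ of the environment let $F_\gamma(u)=\int_u^0\beta_{\gamma(t)}\,dt$ for $u\le 0$, let $A_\gamma=\{(u,\sigma):u<0,\ \sigma>0,\ \sigma>F_\gamma(u)\}$, and let $|A_\gamma|$ be the measure of $A_\gamma$ under $\lambda_{\gamma(u)}\,du\;\mu e^{-\mu\sigma}d\sigma$. Let $\Gamma_0$ be the Palm version of the environment (it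 has a transition at time $0$, and its states and sojourn times form a two-sided stationary Markov renewal sequence), and let $\Gamma$ be the corresponding time-stationary version. Let $m_0^{(n)},m^{(n)}\in\mathbb{R}^K$ be the vectors with entries $$m_{0k}^{(n)}=\mathbb{E}\big[|A_{\Gamma_0}|^n\,\big|\,\Gamma_0(0^-)=k\big],\qquad m_k^{(n)}=\mathbb{E}\big[|A_{\Gamma}|^n\,\big|\,\Gamma(0)=k\big].$$ Let $\tau^*_k$ be the Laplace transform of the residual sojourn time in state $k$, which has density $\mathbb{P}(T_k>x)/\mathbb{E}[T_k]$ on $(0,\infty)$, and let $R=\mathrm{diag}(\rho_k)$ and $E_n=\mathrm{diag}\big(\tau^*_k(n\mu_k)/\tau_k(n\mu_k)\big)$. Then all these moments are finite and, for every $n\ge 0$, $$\sum_{j=0}^n(-1)^j\binom nj R^{n-j}\big[m^{(j)}-E_n m_0^{(j)}\big]=0 ,$$ so that $m^{(n)}$ is given recursively by $$m^{(n)}=E_n m_0^{(n)}+\sum_{j=0}^{n-1}(-1)^{n-1-j}\binom nj R^{n-j}\big[m^{(j)}-E_n m_0^{(j)}\big].$$ Moreover $$\mathbb{E}\big[|A_\Gamma|^n\big]=\sum_{k=1}^K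 \omega_k\, m^{(n)}_k<\infty,\qquad \omega_k=\frac{\pi_k\,\mathbb{E}[T_k]}{\sum_{j}\pi_j\,\mathbb{E}[T_j]},$$ where $\omega$ is the stationary distribution of $\Gamma(0)$. Finally, the number $N$ of customers present at time $0$ in the stationary regime is almost surely finite, and its $n$-th factorial moment $\mathbb{E}[N(N-1)\cdots(N-n+1)]$ equals $\mathbb{E}\big[|A_\Gamma|^n\big]$. -/

import Mathlib

open MeasureTheory ProbabilityTheory
open scoped ENNReal

noncomputable section

namespace MMInf

/-- Data of an M/M/∞ queue in a semi-Markovian environment with state space `Fin K`: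
arrival rates `lam k`, service requirement rate `mu`, server speeds `beta k`, routing matrix `P`
and sojourn time laws `sojourn k`, which live on `(0, ∞)` and have finite mean. -/
structure Queue (K : ℕ) where
  lam : Fin K → ℝ
  mu : ℝ
  beta : Fin K → ℝ
  P : Matrix (Fin K) (Fin K) ℝ
  sojourn : Fin K → Measure ℝ
  lam_nonneg : ∀ k, 0 ≤ lam k
  exists_lam_pos : ∃ k, 0 < lam k
  mu_pos : 0 < mu
  beta_nonneg : ∀ k, 0 ≤ beta k
  P_stochastic : P ∈ Matrix.rowStochastic ℝ (Fin K)
  P_irreducible : P.IsIrreducible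
  sojourn_prob : ∀ k, IsProbabilityMeasure (sojourn k)
  sojourn_pos : ∀ k, ∀ᵐ x ∂(sojourn k), 0 < x
  sojourn_integrable : ∀ k, Integrable (fun x : ℝ => x) (sojourn k)

/-! ### The environment -/

section Paths

/-- Transition epochs `S i` of an environment with successive sojourn times `T i`, normalised by
`S 0 = 0`; thus `S (i + 1) = S i + T i`. -/
def epoch (T : ℤ → ℝ) (i : ℤ) : ℝ :=
  ∑ j ∈ Finset.Ico 0 i, T j - ∑ j ∈ Finset.Ico i 0, T j

open Classical in
/-- The right-continuous path equal to `X i` on `[S i, S (i + 1))`. The value `0` at times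
that no such interval contains is immaterial: almost surely there are no such times. -/
def path {K : ℕ} [NeZero K] (X : ℤ → Fin K) (T : ℤ → ℝ) (t : ℝ) : Fin K :=
  if h : ∃ i, epoch T i ≤ t ∧ t < epoch T (i + 1) then X h.choose else 0

end Paths

namespace Queue

variable {K : ℕ}

/-- `μ_k = μ β_k`. -/
def muState (Q : Queue K) (k : Fin K) : ℝ := Q.mu * Q.beta k

/-- `ρ_k = λ_k / μ_k`; here `0 / 0 = 0`. -/
def rho (Q : Queue K) (k : Fin K) : ℝ := Q.lam k / Q.muState k

/-- `E[T_k]`. -/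
def meanSojourn (Q : Queue K) (k : Fin K) : ℝ := ∫ x, x ∂(Q.sojourn k)

/-- Law of the residual sojourn time in state `k`: density `P(T_k > x) / E[T_k]` on `(0, ∞)`. -/
def residual (Q : Queue K) (k : Fin K) : Measure ℝ :=
  (volume.restrict (Set.Ioi 0)).withDensity
    (fun x => ENNReal.ofReal ((Q.sojourn k).real (Set.Ioi x) / Q.meanSojourn k))

/-- `R = diag(ρ_k)`. -/
def R (Q : Queue K) : Matrix (Fin K) (Fin K) ℝ := Matrix.diagonal Q.rho

/-- Laplace transform of the sojourn time in state `k`. -/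
def tau (Q : Queue K) (k : Fin K) (s : ℝ) : ℝ := ∫ x, Real.exp (-s * x) ∂(Q.sojourn k)

/-- Laplace transform of the residual sojourn time in state `k`. -/
def tauStar (Q : Queue K) (k : Fin K) (s : ℝ) : ℝ := ∫ x, Real.exp (-s * x) ∂(Q.residual k)

/-- `E_n = diag(τ*_k(n μ_k) / τ_k(n μ_k))`. -/
def E (Q : Queue K) (n : ℕ) : Matrix (Fin K) (Fin K) ℝ :=
  Matrix.diagonal (fun k => Q.tauStar k ((n : ℝ) * Q.muState k) / Q.tau k ((n : ℝ) * Q.muState k))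

/-- `π` is a stationary distribution of the Markov chain generated by `P`. -/
structure IsStationary (Q : Queue K) (π : Fin K → ℝ) : Prop where
  nonneg : ∀ k, 0 ≤ π k
  sum_eq_one : ∑ k, π k = 1
  invariant : Matrix.vecMul π Q.P = π

/-- Stationary distribution in continuous time of the environment: its `k`-th entry is
`π_k E[T_k] / ∑_j π_j E[T_j]`. -/
def timeDist (Q : Queue K) (π : Fin K → ℝ) (k : Fin K) : ℝ :=
  π k * Q.meanSojourn k / ∑ j, π j * Q.meanSojourn j

/-- Under `ℙ₀`, the states `X i` and sojourn times `T i`, `i ∈ ℤ`, form a stationary Markov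
renewal sequence: `X` is the stationary Markov chain with transition matrix `P`, and given `X` the
`T i` are independent with `T i` of law `sojourn (X i)`. Then `path X T` is the Palm version of the
environment, which has a transition at time `0`. -/
structure IsPalmEnvironment (Q : Queue K) (π : Fin K → ℝ) {Ω : Type*} [MeasurableSpace Ω]
    (ℙ₀ : Measure Ω) (X : ℤ → Ω → Fin K) (T : ℤ → Ω → ℝ) : Prop where
  measurable_X : ∀ i, Measurable (X i)
  measurable_T : ∀ i, Measurable (T i)
  law : ∀ (i : ℤ) (n : ℕ) (x : ℕ → Fin K) (B : ℕ → Set ℝ), (∀ j, MeasurableSet (B j)) →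
    ℙ₀ {ω | ∀ j ≤ n, X (i + j) ω = x j ∧ T (i + j) ω ∈ B j} =
      ENNReal.ofReal (π (x 0) * ∏ j ∈ Finset.range n, Q.P (x j) (x (j + 1))) *
        ∏ j ∈ Finset.range (n + 1), Q.sojourn (x j) (B j)

/-! ### The set `A_Γ` and its measure -/

/-- `F_γ(u) = ∫_u^0 β_{γ(t)} dt`. -/
def work (Q : Queue K) (γ : ℝ → Fin K) (u : ℝ) : ℝ := ∫ t in u..0, Q.beta (γ t)

/-- `A_γ = {(u, σ) : u < 0, σ > 0, σ > F_γ(u)}`. -/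
def region (Q : Queue K) (γ : ℝ → Fin K) : Set (ℝ × ℝ) :=
  {p | p.1 < 0 ∧ 0 < p.2 ∧ Q.work γ p.1 < p.2}

/-- The intensity measure `λ_{γ(u)} du G(dσ)` with `G` the exponential law of rate `μ`. -/
def intensity (Q : Queue K) (γ : ℝ → Fin K) : Measure (ℝ × ℝ) :=
  (volume.withDensity (fun u => ENNReal.ofReal (Q.lam (γ u)))).prod (expMeasure Q.mu)

/-- `|A_γ|_γ`. -/
def area (Q : Queue K) (γ : ℝ → Fin K) : ℝ≥0∞ := Q.intensity γ (Q.region γ)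

end Queue

section Environments

variable {K : ℕ} [NeZero K] {Ω : Type*} [MeasurableSpace Ω]

/-- The path `Γ₀` of the Palm version of the environment. -/
def palmPath (X : ℤ → Ω → Fin K) (T : ℤ → Ω → ℝ) (ω : Ω) : ℝ → Fin K :=
  path (fun i => X i ω) (fun i => T i ω)

/-- The law on `Ω × ℝ` of the stationary regime, given by Palm inversion: the Palm version is
biased by the length `T 0` of the sojourn starting at time `0`, and a new time origin `s` is chosen
uniformly in `[0, T 0)`, so that
`E f(Γ) = E₀[∫_0^{T 0} f(Γ₀(· + s)) ds] / E₀[T 0]`. -/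
def stationaryLaw (ℙ₀ : Measure Ω) (T : ℤ → Ω → ℝ) : Measure (Ω × ℝ) :=
  ProbabilityTheory.cond (ℙ₀.prod volume) {z | 0 ≤ z.2 ∧ z.2 < T 0 z.1}

/-- The path `Γ` of the stationary version of the environment. -/
def statPath (X : ℤ → Ω → Fin K) (T : ℤ → Ω → ℝ) (z : Ω × ℝ) : ℝ → Fin K :=
  fun t => palmPath X T z.1 (t + z.2)

/-- `n`-th moment of `|A_{Γ₀}|` given that the last state occupied before `0` is `k`. -/
def palmMoment (Q : Queue K) (ℙ₀ : Measure Ω) (X : ℤ → Ω → Fin K) (T : ℤ → Ω → ℝ)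
    (n : ℕ) (k : Fin K) : ℝ≥0∞ :=
  ∫⁻ ω, Q.area (palmPath X T ω) ^ n ∂(ProbabilityTheory.cond ℙ₀ {ω | X (-1) ω = k})

/-- `n`-th moment of `|A_Γ|` given `Γ(0) = k`. -/
def statMoment (Q : Queue K) (ℙ₀ : Measure Ω) (X : ℤ → Ω → Fin K) (T : ℤ → Ω → ℝ)
    (n : ℕ) (k : Fin K) : ℝ≥0∞ :=
  ∫⁻ z, Q.area (statPath X T z) ^ n
    ∂(ProbabilityTheory.cond (stationaryLaw ℙ₀ T) {z | statPath X T z 0 = k})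

/-- `n`-th moment of `|A_Γ|`. -/
def totalMoment (Q : Queue K) (ℙ₀ : Measure Ω) (X : ℤ → Ω → Fin K) (T : ℤ → Ω → ℝ)
    (n : ℕ) : ℝ≥0∞ :=
  ∫⁻ z, Q.area (statPath X T z) ^ n ∂(stationaryLaw ℙ₀ T)

/-- The real vector `m₀^(n)`. -/
def palmVec (Q : Queue K) (ℙ₀ : Measure Ω) (X : ℤ → Ω → Fin K) (T : ℤ → Ω → ℝ) (n : ℕ) :
    Fin K → ℝ :=
  fun k => (palmMoment Q ℙ₀ X T n k).toReal

/-- The real vector `m^(n)`. -/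
def statVec (Q : Queue K) (ℙ₀ : Measure Ω) (X : ℤ → Ω → Fin K) (T : ℤ → Ω → ℝ) (n : ℕ) :
    Fin K → ℝ :=
  fun k => (statMoment Q ℙ₀ X T n k).toReal

end Environments

/-! ### Customers -/

/-- Under `L`, the random measure `Φ` is a Poisson process with intensity measure `ν`. -/
structure IsPoissonProcess {C α : Type*} [MeasurableSpace C] [MeasurableSpace α]
    (L : Measure C) (Φ : C → Measure α) (ν : Measure α) : Prop where
  measurable : ∀ B, MeasurableSet B → Measurable (fun c => Φ c B)
  law : ∀ B, MeasurableSet B → ν B ≠ ∞ → ∀ n : ℕ,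
    L {c | Φ c B = n} = poissonMeasure (ν B).toNNReal {n}
  indep : ∀ (m : ℕ) (B : Fin m → Set α), (∀ i, MeasurableSet (B i)) →
    Pairwise (Function.onFun Disjoint B) → iIndepFun (fun i c => Φ c (B i)) L

/-- Conditional law `L`, given that the environment is `γ`, of the arrival times `c.1 n` and service
requests `c.2 n` of the customers arriving before time `0`, listed backwards in time
(`c.1 0` is the last arrival before `0`): the arrival times form a Poisson process of rate `λ_{γ(u)}`
on `(-∞, 0)`, and the service requests are i.i.d. exponential of rate `μ`, independent of them. -/
structure Queue.IsCustomerLaw {K : ℕ} (Q : Queue K) (γ : ℝ → Fin K)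
    (L : Measure ((ℕ → ℝ) × (ℕ → ℝ))) : Prop where
  ordered : ∀ᵐ c ∂L, StrictAnti c.1 ∧ ∀ n, c.1 n < 0
  arrivals : IsPoissonProcess L (fun c => Measure.sum (fun n => Measure.dirac (c.1 n)))
    ((volume.restrict (Set.Iio 0)).withDensity (fun u => ENNReal.ofReal (Q.lam (γ u))))
  service_law : ∀ n, L.map (fun c => c.2 n) = expMeasure Q.mu
  service_indep : iIndepFun (fun n (c : (ℕ → ℝ) × (ℕ → ℝ)) => c.2 n) L
  indep : IndepFun Prod.fst Prod.snd L

/-- The number of customers present at time `0`: those whose service request exceeds the work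
done for them since their arrival. -/
def Queue.numCustomers {K : ℕ} (Q : Queue K) (γ : ℝ → Fin K) (c : (ℕ → ℝ) × (ℕ → ℝ)) : ℕ∞ :=
  {n | Q.work γ (c.1 n) < c.2 n}.encard

end MMInf

end

set_option linter.unusedSectionVars false

noncomputable section

namespace MMInf

/-! Suppose a path has been in state `k` for time `s`, and let `A'` be the region of the path seen
from the start of that sojourn. Cutting `A` at `u = -s` (`Queue.area_shift`) gives `ρ_k - |A| =
exp(-μ_k s) (ρ_k - |A'|)`. For `Γ₀`, given the last state `k`, the time `s` is a full sojourn; for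
`Γ`, given `Γ(0) = k`, it is the age of the current sojourn, which has the residual law. In both
cases `s` is independent of the history before that sojourn, and the history has the same law
(`map_history_sojourn`, `setLIntegral_sojournGraph`).

Taking `n`-th powers and expectations, `E(ρ_k - |A|)^n` equals `τ_k(nμ_k) h` for `Γ₀` and
`τ*_k(nμ_k) h` for `Γ`, with the same `h = E(ρ_k - |A'|)^n`. The binomial theorem
(`binomial_moments`) and elimination of `h` give the implicit relation; its term `j = n` carries
`R^0 = 1`, so it can be solved for `m^(n)`. Finiteness is a pathwise matter: `λ_k = ρ_k μ β_k`, and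
the work done since an arrival is the integral of `β`, so `|A_γ| ≤ ∑ ρ_k` for every path
(`area_le`).

For the customers, fix the environment. Averaging out the service requests and then applying the
Laplace functional of the Poisson arrivals gives `E exp(-aN) = exp(-(1 - e^{-a}) |A|)`. Hence `N` is
Poisson with mean `|A|` (`measure_countPresent_eq`), its `n`-th factorial moment is `|A|^n`, and it
remains to average over the environment. -/

theorem expMeasure_Ioi {r x : ℝ} (hr : 0 < r) (hx : 0 ≤ x) :
    expMeasure r (Set.Ioi x) = ENNReal.ofReal (Real.exp (-(r * x))) := by
  have := isProbabilityMeasure_expMeasure hr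
  have h := cdf_expMeasure_eq hr x
  rw [if_pos hx, cdf_eq_real] at h
  have h2 : (expMeasure r).real (Set.Ioi x) = Real.exp (-(r * x)) := by
    rw [← Set.compl_Iic, probReal_compl_eq_one_sub measurableSet_Iic, h]; ring
  rw [← h2, ofReal_measureReal]

theorem expMeasure_Ioi_zero {r : ℝ} (hr : 0 < r) : expMeasure r (Set.Ioi 0) = 1 := by
  simp [expMeasure_Ioi hr le_rfl]

theorem ae_pos_expMeasure {r : ℝ} (hr : 0 < r) : ∀ᵐ x ∂(expMeasure r), 0 < x := by
  have := isProbabilityMeasure_expMeasure hr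
  exact (mem_ae_iff_prob_eq_one measurableSet_Ioi).2 (expMeasure_Ioi_zero hr)

/-- The mean of the exponential law. -/
theorem lintegral_id_expMeasure {r : ℝ} (hr : 0 < r) :
    ∫⁻ x, ENNReal.ofReal x ∂(expMeasure r) = ENNReal.ofReal r⁻¹ := by
  have := isProbabilityMeasure_expMeasure hr
  rw [lintegral_eq_lintegral_meas_lt (expMeasure r) (f := fun x => x)
    ((ae_pos_expMeasure hr).mono fun x hx => hx.le) measurable_id.aemeasurable]
  rw [setLIntegral_congr_fun (g := fun t => ENNReal.ofReal (Real.exp (-r * t))) measurableSet_Ioi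
    fun t ht => by
      have := expMeasure_Ioi hr (le_of_lt ht)
      rw [← neg_mul] at this; exact this]
  rw [← ofReal_integral_eq_lintegral_ofReal (integrableOn_exp_mul_Ioi (by linarith) 0)
    (ae_of_all _ fun t => (Real.exp_pos _).le), integral_exp_mul_Ioi (by linarith)]
  simp

/-! ### The measure of `A_γ` for a fixed path. -/

namespace Queue

variable {K : ℕ} (Q : Queue K)

theorem muState_nonneg (k : Fin K) : 0 ≤ Q.muState k :=
  mul_nonneg Q.mu_pos.le (Q.beta_nonneg k)

theorem rho_nonneg (k : Fin K) : 0 ≤ Q.rho k := div_nonneg (Q.lam_nonneg k) (Q.muState_nonneg k)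

variable {Q} in
theorem rho_mul_muState (hρ : ∀ k, Q.beta k = 0 → Q.lam k = 0) (k : Fin K) :
    Q.rho k * Q.muState k = Q.lam k := by
  by_cases h : Q.beta k = 0
  · simp [rho, hρ k h]
  · exact div_mul_cancel₀ _ (mul_ne_zero Q.mu_pos.ne' h)

/-- An upper bound for the measure of `A_γ`, for every path `γ`. -/
def rhoBound : ℝ := ∑ k, Q.rho k

theorem rho_le_rhoBound (k : Fin K) : Q.rho k ≤ Q.rhoBound :=
  Finset.single_le_sum (fun i _ => Q.rho_nonneg i) (Finset.mem_univ k)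

theorem rhoBound_nonneg : 0 ≤ Q.rhoBound := Finset.sum_nonneg fun i _ => Q.rho_nonneg i

theorem measurable_comp_state (f : Fin K → ℝ) {α : Type*} [MeasurableSpace α] {g : α → Fin K}
    (hg : Measurable g) : Measurable fun a => f (g a) :=
  (measurable_of_countable f).comp hg

section Work

variable {γ : ℝ → Fin K}

theorem intervalIntegrable_beta (hγ : Measurable γ) (a b : ℝ) :
    IntervalIntegrable (fun t => Q.beta (γ t)) volume a b := by
  rw [intervalIntegrable_iff]
  refine Measure.integrableOn_of_bounded (M := ∑ k, Q.beta k) (by simp)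
    (measurable_comp_state Q.beta hγ).aestronglyMeasurable (ae_of_all _ fun t => ?_)
  rw [Real.norm_of_nonneg (Q.beta_nonneg _)]
  exact Finset.single_le_sum (fun i _ => Q.beta_nonneg i) (Finset.mem_univ (γ t))

theorem continuous_work (hγ : Measurable γ) : Continuous (Q.work γ) := by
  have h : Q.work γ = fun u => -∫ t in (0 : ℝ)..u, Q.beta (γ t) := by
    ext u; rw [work, intervalIntegral.integral_symm]
  rw [h]
  exact (intervalIntegral.continuous_primitive (Q.intervalIntegrable_beta hγ) 0).neg

theorem work_nonneg {u : ℝ} (hu : u ≤ 0) : 0 ≤ Q.work γ u :=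
  intervalIntegral.integral_nonneg hu fun _ _ => Q.beta_nonneg _

theorem measurableSet_region (hγ : Measurable γ) : MeasurableSet (Q.region γ) := by
  have := (Q.continuous_work hγ).measurable
  refine (measurableSet_lt measurable_fst measurable_const).inter
    ((measurableSet_lt measurable_const measurable_snd).inter
      (measurableSet_lt (this.comp measurable_fst) measurable_snd))

theorem measurable_lam (hγ : Measurable γ) : Measurable fun u => ENNReal.ofReal (Q.lam (γ u)) :=
  (measurable_comp_state Q.lam hγ).ennreal_ofReal

theorem measurable_exp_work (hγ : Measurable γ) :
    Measurable fun u => ENNReal.ofReal (Real.exp (-(Q.mu * Q.work γ u))) := by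
  have := Q.continuous_work hγ
  have hc : Continuous fun u => Real.exp (-(Q.mu * Q.work γ u)) := by fun_prop
  exact hc.measurable.ennreal_ofReal

/-- Fubini with `σ` integrated first: the section at `u` is an exponential tail. The constraint `σ >
0` is absorbed by `σ > F_γ(u)`, since `F_γ(u) ≥ 0` for `u < 0`. -/
theorem area_eq_lintegral (hγ : Measurable γ) :
    Q.area γ = ∫⁻ u in Set.Iio 0,
      ENNReal.ofReal (Q.lam (γ u)) * ENNReal.ofReal (Real.exp (-(Q.mu * Q.work γ u))) := by
  have := isProbabilityMeasure_expMeasure Q.mu_pos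
  rw [area, intensity, Measure.prod_apply (Q.measurableSet_region hγ)]
  have hm := measurable_measure_prodMk_left (ν := expMeasure Q.mu) (Q.measurableSet_region hγ)
  rw [lintegral_withDensity_eq_lintegral_mul _ (Q.measurable_lam hγ) hm,
    ← lintegral_indicator measurableSet_Iio]
  refine lintegral_congr fun u => ?_
  by_cases hu : u < 0
  · rw [Set.indicator_of_mem (by exact hu), Pi.mul_apply,
      ← expMeasure_Ioi Q.mu_pos (Q.work_nonneg hu.le)]
    congr 2
    ext σ
    simp only [region, Set.mem_preimage, Set.mem_ofPred_eq, Set.mem_Ioi]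
    have := Q.work_nonneg (γ := γ) hu.le
    constructor
    · exact fun h => h.2.2
    · exact fun h => ⟨hu, this.trans_lt h, h⟩
  · rw [Set.indicator_of_notMem (by exact hu), Pi.mul_apply]
    have : Prod.mk u ⁻¹' Q.region γ = ∅ := by
      ext σ; simp [region, hu]
    simp [this]

/-- By continuity of `F_γ`, the domain is covered by the intervals `(q, 0)` with `q` rational and
`F_γ(q) < σ`. They are nested, so the integral over their union is the supremum of the integrals
over each, and each of these is `F_γ(q)`. -/
theorem lintegral_beta_le (hγ : Measurable γ) (σ : ℝ) :
    ∫⁻ u in {u | u < 0 ∧ Q.work γ u < σ}, ENNReal.ofReal (Q.beta (γ u)) ≤ ENNReal.ofReal σ := by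
  have hS : {u | u < 0 ∧ Q.work γ u < σ} ⊆
      ⋃ q : {q : ℚ // (q : ℝ) < 0 ∧ Q.work γ q < σ}, Set.Ioo (q.1 : ℝ) 0 := by
    rintro u ⟨hu, huσ⟩
    have hev : ∀ᶠ v in nhds u, Q.work γ v < σ :=
      (Q.continuous_work hγ).continuousAt.eventually_lt continuousAt_const huσ
    obtain ⟨a, ha, h⟩ := exists_Ioc_subset_of_mem_nhds hev ⟨u - 1, by simp⟩
    obtain ⟨q, hq1, hq2⟩ := exists_rat_btwn ha
    exact Set.mem_iUnion.2 ⟨⟨q, hq2.trans hu, h ⟨hq1, hq2.le⟩⟩, hq2, hu⟩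
  refine (lintegral_mono_set hS).trans ?_
  rw [setLIntegral_iUnion_of_directed]
  · refine iSup_le fun q => ?_
    rw [← ofReal_integral_eq_lintegral_ofReal]
    · refine ENNReal.ofReal_le_ofReal ?_
      rw [← integral_Ioc_eq_integral_Ioo, ← intervalIntegral.integral_of_le q.2.1.le]
      exact q.2.2.le
    · exact ((intervalIntegrable_iff_integrableOn_Ioo_of_le q.2.1.le).1
        (Q.intervalIntegrable_beta hγ _ _))
    · exact ae_of_all _ fun u => Q.beta_nonneg _
  · intro p q
    rcases le_total p.1 q.1 with h | h
    · exact ⟨p, subset_rfl, Set.Ioo_subset_Ioo_left (by exact_mod_cast h)⟩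
    · exact ⟨q, Set.Ioo_subset_Ioo_left (by exact_mod_cast h), subset_rfl⟩

/-- Fubini with `u` integrated first: for fixed `σ` the arrival rate is at most `rhoBound * μ * β`,
so the section has measure at most `rhoBound * μ * σ`, and the exponential law has mean `1 / μ`. The
bound is uniform in the path, whence the finiteness of all moments. -/
theorem area_le (hρ : ∀ k, Q.beta k = 0 → Q.lam k = 0) (hγ : Measurable γ) :
    Q.area γ ≤ ENNReal.ofReal Q.rhoBound := by
  have := isProbabilityMeasure_expMeasure Q.mu_pos
  have hC : ENNReal.ofReal (Q.rhoBound * Q.mu) ≠ ∞ := ENNReal.ofReal_ne_top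
  rw [area, intensity, Measure.prod_apply_symm (Q.measurableSet_region hγ)]
  calc ∫⁻ σ, volume.withDensity (fun u => ENNReal.ofReal (Q.lam (γ u)))
          ((fun u => (u, σ)) ⁻¹' Q.region γ) ∂(expMeasure Q.mu)
      ≤ ∫⁻ σ, ENNReal.ofReal (Q.rhoBound * Q.mu) * ENNReal.ofReal σ ∂(expMeasure Q.mu) := by
        refine lintegral_mono fun σ => ?_
        rw [withDensity_apply _ (measurable_prodMk_right (Q.measurableSet_region hγ))]
        refine le_trans ?_ (mul_le_mul_right (Q.lintegral_beta_le hγ σ) _)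
        rw [← lintegral_const_mul' _ _ hC]
        refine (lintegral_mono_set (t := {u | u < 0 ∧ Q.work γ u < σ})
          fun u hu => ⟨hu.1, hu.2.2⟩).trans (lintegral_mono fun u => ?_)
        rw [← ENNReal.ofReal_mul (mul_nonneg Q.rhoBound_nonneg Q.mu_pos.le)]
        refine ENNReal.ofReal_le_ofReal ?_
        rw [← rho_mul_muState hρ, muState, mul_assoc]
        exact mul_le_mul_of_nonneg_right (Q.rho_le_rhoBound _)
          (mul_nonneg Q.mu_pos.le (Q.beta_nonneg _))
    _ = ENNReal.ofReal Q.rhoBound := by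
        rw [lintegral_const_mul' _ _ hC, lintegral_id_expMeasure Q.mu_pos,
          ← ENNReal.ofReal_mul (mul_nonneg Q.rhoBound_nonneg Q.mu_pos.le), mul_assoc,
          mul_inv_cancel₀ Q.mu_pos.ne', mul_one]

theorem work_congr {γ' : ℝ → Fin K} (h : ∀ t < 0, γ t = γ' t) {u : ℝ} (hu : u ≤ 0) :
    Q.work γ u = Q.work γ' u := by
  refine intervalIntegral.integral_congr_ae ?_
  -- The paths may differ at the right endpoint `t = 0`, which is a null set.
  have h0 : ∀ᵐ t : ℝ, t ≠ 0 := by simp [ae_iff]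
  filter_upwards [h0] with t ht htu
  rw [Set.uIoc_of_le hu] at htu
  rw [h t (lt_of_le_of_ne htu.2 ht)]

theorem area_congr {γ' : ℝ → Fin K} (hγ : Measurable γ) (hγ' : Measurable γ')
    (h : ∀ t < 0, γ t = γ' t) : Q.area γ = Q.area γ' := by
  rw [Q.area_eq_lintegral hγ, Q.area_eq_lintegral hγ']
  refine setLIntegral_congr_fun measurableSet_Iio fun u hu => ?_
  have hu' : u < 0 := hu
  simp only [h u hu', Q.work_congr h hu'.le]

theorem work_of_eq_const {k : Fin K} {s u : ℝ} (hk : ∀ t, -s ≤ t → t < 0 → γ t = k)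
    (hu : -s ≤ u) (hu0 : u ≤ 0) : Q.work γ u = -u * Q.beta k := by
  have : Q.work γ u = ∫ t in u..0, Q.beta k := by
    refine intervalIntegral.integral_congr_ae ?_
    have h0 : ∀ᵐ t : ℝ, t ≠ 0 := by simp [ae_iff]
    filter_upwards [h0] with t ht htu
    rw [Set.uIoc_of_le hu0] at htu
    rw [hk t (hu.trans htu.1.le) (lt_of_le_of_ne htu.2 ht)]
  rw [this]; simp

theorem work_sub_shift (hγ : Measurable γ) {k : Fin K} {s : ℝ} (hs : 0 ≤ s)
    (hk : ∀ t, -s ≤ t → t < 0 → γ t = k) (v : ℝ) :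
    Q.work γ (v - s) = Q.work (fun t => γ (t - s)) v + s * Q.beta k := by
  have h1 := intervalIntegral.integral_add_adjacent_intervals
    (Q.intervalIntegrable_beta hγ (v - s) (-s)) (Q.intervalIntegrable_beta hγ (-s) 0)
  have h2 : ∫ t in (-s)..0, Q.beta (γ t) = s * Q.beta k := by
    have := Q.work_of_eq_const hk le_rfl (neg_nonpos.2 hs)
    rw [neg_neg] at this; exact this
  rw [h2] at h1
  rw [work, ← h1, work]
  congr 1
  have := intervalIntegral.integral_comp_sub_right (a := v) (b := 0) (fun t => Q.beta (γ t)) s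
  rw [this, zero_sub]

/-- This is the contribution of the current sojourn to `|A_γ|`. The case `β_k = 0` is separate
because the primitive divides by `μ_k`; there `λ_k` and `ρ_k` both vanish. -/
theorem lintegral_sojourn (hρ : ∀ k, Q.beta k = 0 → Q.lam k = 0) (k : Fin K) {s : ℝ}
    (hs : 0 ≤ s) :
    ∫⁻ u in Set.Ico (-s) 0, ENNReal.ofReal (Q.lam k) *
      ENNReal.ofReal (Real.exp (-(Q.mu * (-u * Q.beta k)))) =
    ENNReal.ofReal (Q.rho k * (1 - Real.exp (-(Q.muState k * s)))) := by
  by_cases hb : Q.beta k = 0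
  · simp [hρ k hb, rho]
  have hm : Q.muState k ≠ 0 := mul_ne_zero Q.mu_pos.ne' hb
  have hcont : Continuous fun u => Q.lam k * Real.exp (-(Q.mu * (-u * Q.beta k))) := by fun_prop
  simp_rw [← ENNReal.ofReal_mul (Q.lam_nonneg k)]
  rw [← ofReal_integral_eq_lintegral_ofReal
    ((hcont.integrableOn_Icc (a := -s) (b := 0)).mono_set Set.Ico_subset_Icc_self)
    (ae_of_all _ fun u => mul_nonneg (Q.lam_nonneg k) (Real.exp_pos _).le)]
  congr 1
  rw [integral_Ico_eq_integral_Ioo, ← integral_Ioc_eq_integral_Ioo,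
    ← intervalIntegral.integral_of_le (neg_nonpos.2 hs)]
  have : ∀ u : ℝ, Q.lam k * Real.exp (-(Q.mu * (-u * Q.beta k))) =
      Q.lam k * Real.exp (Q.muState k * u) := fun u => by rw [muState]; congr 2; ring
  simp_rw [this]
  rw [intervalIntegral.integral_const_mul,
    intervalIntegral.integral_comp_mul_left (fun x => Real.exp x) hm, integral_exp, rho]
  simp only [mul_zero, Real.exp_zero, smul_eq_mul, mul_neg]
  field_simp

/-- The measure of `A_γ` for a path that has been in state `k` since time `-s`. -/
theorem area_shift (hρ : ∀ k, Q.beta k = 0 → Q.lam k = 0) (hγ : Measurable γ) {k : Fin K} {s : ℝ}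
    (hs : 0 ≤ s) (hk : ∀ t, -s ≤ t → t < 0 → γ t = k) :
    Q.area γ = ENNReal.ofReal (Q.rho k * (1 - Real.exp (-(Q.muState k * s)))) +
      ENNReal.ofReal (Real.exp (-(Q.muState k * s))) * Q.area (fun t => γ (t - s)) := by
  have hγ' : Measurable fun t => γ (t - s) := hγ.comp (measurable_sub_const s)
  rw [Q.area_eq_lintegral hγ, Q.area_eq_lintegral hγ', ← Q.lintegral_sojourn hρ k hs]
  -- The current sojourn occupies `[-s, 0)`. For arrivals before `-s` the work done exceeds that of
  -- the shifted path by `s β_k`, which produces the factor `exp(-μ_k s)`.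
  have hu : Set.Iio (0 : ℝ) = Set.Ico (-s) 0 ∪ Set.Iio (-s) := by
    rw [Set.union_comm, Set.Iio_union_Ico_eq_Iio (by linarith)]
  rw [hu, lintegral_union measurableSet_Iio
    (Set.disjoint_left.2 fun x hx hx' => not_lt.2 hx.1 hx')]
  -- The rewriting with `hu` also split the domain of the integral on the right, which is restored
  -- here.
  rw [← hu]
  congr 1
  · refine setLIntegral_congr_fun measurableSet_Ico fun u hu => ?_
    simp only [hk u hu.1 hu.2, Q.work_of_eq_const hk hu.1 hu.2.le]
  · rw [← lintegral_const_mul' _ _ ENNReal.ofReal_ne_top]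
    have := (measurePreserving_sub_right volume s).setLIntegral_comp_preimage
      (s := Set.Iio (-s)) measurableSet_Iio
      ((Q.measurable_lam hγ).mul (Q.measurable_exp_work hγ))
    simp only [Pi.mul_apply] at this
    rw [← this]
    have hp : (fun x : ℝ => x - s) ⁻¹' Set.Iio (-s) = Set.Iio 0 := by
      ext x; simp
    rw [hp]
    refine lintegral_congr fun v => ?_
    rw [Q.work_sub_shift hγ hs hk, mul_left_comm, ← ENNReal.ofReal_mul (Real.exp_pos _).le,
      ← Real.exp_add]
    congr 3
    rw [muState]; ring

end Work

end Queue

/-! ### Epochs and paths of a sequence of sojourn times. -/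

theorem epoch_zero (T : ℤ → ℝ) : epoch T 0 = 0 := by simp [epoch]

theorem epoch_succ (T : ℤ → ℝ) (i : ℤ) : epoch T (i + 1) = epoch T i + T i := by
  rcases lt_or_ge i 0 with h | h
  · have h1 : Finset.Ico (0 : ℤ) i = ∅ := Finset.Ico_eq_empty (by lia)
    have h2 : Finset.Ico (0 : ℤ) (i + 1) = ∅ := Finset.Ico_eq_empty (by lia)
    have h3 : Finset.Ico i 0 = insert i (Finset.Ico (i + 1) 0) := by
      ext; simp only [Finset.mem_Ico, Finset.mem_insert]; lia
    rw [epoch, epoch, h1, h2, h3, Finset.sum_insert (by simp)]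
    simp
  · have h1 : Finset.Ico i (0 : ℤ) = ∅ := Finset.Ico_eq_empty (by lia)
    have h2 : Finset.Ico (i + 1) (0 : ℤ) = ∅ := Finset.Ico_eq_empty (by lia)
    have h3 : Finset.Ico 0 (i + 1) = insert i (Finset.Ico 0 i) := by
      ext; simp only [Finset.mem_Ico, Finset.mem_insert]; lia
    rw [epoch, epoch, h1, h2, h3, Finset.sum_insert (by simp)]
    simp [add_comm]

theorem epoch_neg_one (T : ℤ → ℝ) : epoch T (-1) = -T (-1) := by
  have := epoch_succ T (-1)
  rw [show (-1 : ℤ) + 1 = 0 by norm_num, epoch_zero] at this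
  linarith

theorem epoch_one (T : ℤ → ℝ) : epoch T 1 = T 0 := by
  have := epoch_succ T 0
  rwa [epoch_zero, zero_add, zero_add] at this

theorem epoch_strictMono {T : ℤ → ℝ} (hT : ∀ i, 0 < T i) : StrictMono (epoch T) :=
  strictMono_int_of_lt_succ fun i => by rw [epoch_succ]; linarith [hT i]

theorem epoch_interval_unique {T : ℤ → ℝ} (hT : ∀ i, 0 < T i) {t : ℝ} {i j : ℤ}
    (hi : epoch T i ≤ t ∧ t < epoch T (i + 1)) (hj : epoch T j ≤ t ∧ t < epoch T (j + 1)) :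
    i = j := by
  have h1 := (epoch_strictMono hT).lt_iff_lt.1 (hi.1.trans_lt hj.2)
  have h2 := (epoch_strictMono hT).lt_iff_lt.1 (hj.1.trans_lt hi.2)
  lia

/-- Lowering the indices by one moves the time origin to the preceding transition, which occurs at
time `-T (-1)`. -/
theorem epoch_shift (T : ℤ → ℝ) (i : ℤ) :
    epoch (fun i => T (i - 1)) i = epoch T (i - 1) + T (-1) := by
  induction i using Int.induction_on with
  | zero => rw [epoch_zero, zero_sub, epoch_neg_one]; ring
  | succ i ih =>
    have h := epoch_succ T ((i : ℤ) - 1)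
    rw [sub_add_cancel] at h
    rw [epoch_succ, ih, add_sub_cancel_right, h]; ring
  | pred i ih =>
    have h := epoch_succ T (-(i : ℤ) - 1 - 1)
    have h' := epoch_succ (fun i => T (i - 1)) (-(i : ℤ) - 1)
    rw [sub_add_cancel] at h h'
    rw [ih] at h'
    linarith

/-- On the nonpositive indices the epochs only depend on the sojourn times before time `0`. -/
theorem epoch_congr_of_nonpos {T T' : ℤ → ℝ} (h : ∀ i < 0, T i = T' i) {i : ℤ} (hi : i ≤ 0) :
    epoch T i = epoch T' i := by
  have h1 : Finset.Ico (0 : ℤ) i = ∅ := Finset.Ico_eq_empty (by lia)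
  simp only [epoch, h1, Finset.sum_empty, zero_sub, neg_inj]
  exact Finset.sum_congr rfl fun j hj => h j (Finset.mem_Ico.1 hj).2

section Path

variable {K : ℕ} [NeZero K]

theorem path_eq {X : ℤ → Fin K} {T : ℤ → ℝ} (hT : ∀ i, 0 < T i) {t : ℝ} {i : ℤ}
    (hi : epoch T i ≤ t ∧ t < epoch T (i + 1)) : path X T t = X i := by
  have h : ∃ i, epoch T i ≤ t ∧ t < epoch T (i + 1) := ⟨i, hi⟩
  rw [path, dif_pos h, epoch_interval_unique hT h.choose_spec hi]

theorem path_eq_zero {X : ℤ → Fin K} {T : ℤ → ℝ} {t : ℝ}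
    (h : ¬∃ i, epoch T i ≤ t ∧ t < epoch T (i + 1)) : path X T t = 0 := by
  rw [path, dif_neg h]

/-- The choice in `path` disappears because the interval containing `t` is unique. What remains is a
countable combination of elementary events, as needed for joint measurability. -/
theorem path_eq_iff {X : ℤ → Fin K} {T : ℤ → ℝ} (hT : ∀ i, 0 < T i) (t : ℝ) (k : Fin K) :
    path X T t = k ↔ (∃ i, (epoch T i ≤ t ∧ t < epoch T (i + 1)) ∧ X i = k) ∨
      (¬(∃ i, epoch T i ≤ t ∧ t < epoch T (i + 1)) ∧ 0 = k) := by
  by_cases h : ∃ i, epoch T i ≤ t ∧ t < epoch T (i + 1)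
  · obtain ⟨i, hi⟩ := h
    rw [path_eq hT hi]
    constructor
    · exact fun h => Or.inl ⟨i, hi, h⟩
    · rintro (⟨j, hj, h⟩ | ⟨h, -⟩)
      · rwa [epoch_interval_unique hT hi hj]
      · exact absurd ⟨i, hi⟩ h
  · rw [path_eq_zero h]
    constructor
    · exact fun h' => Or.inr ⟨h, h'⟩
    · rintro (⟨j, hj, -⟩ | ⟨-, h⟩)
      · exact absurd ⟨j, hj⟩ h
      · exact h

theorem path_shift (X : ℤ → Fin K) {T : ℤ → ℝ} (hT : ∀ i, 0 < T i) (t : ℝ) :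
    path (fun i => X (i - 1)) (fun i => T (i - 1)) t = path X T (t - T (-1)) := by
  by_cases h : ∃ i, epoch T i ≤ t - T (-1) ∧ t - T (-1) < epoch T (i + 1)
  · obtain ⟨i, hi⟩ := h
    rw [path_eq hT hi, path_eq (fun i => hT _) (i := i + 1), add_sub_cancel_right]
    rw [epoch_shift, epoch_shift, add_sub_cancel_right, add_sub_cancel_right]
    constructor <;> linarith [hi.1, hi.2]
  · rw [path_eq_zero h, path_eq_zero]
    rintro ⟨i, hi⟩
    refine h ⟨i - 1, ?_⟩
    rw [epoch_shift, epoch_shift, add_sub_cancel_right] at hi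
    rw [sub_add_cancel]
    constructor <;> linarith [hi.1, hi.2]

theorem path_congr_of_neg {X X' : ℤ → Fin K} {T T' : ℤ → ℝ} (hT : ∀ i, 0 < T i)
    (hT' : ∀ i, 0 < T' i) (hX : ∀ i < 0, X i = X' i) (h : ∀ i < 0, T i = T' i) {t : ℝ}
    (ht : t < 0) : path X T t = path X' T' t := by
  have key : ∀ {S : ℤ → ℝ}, (∀ i, 0 < S i) → ∀ {i : ℤ}, epoch S i ≤ t → i < 0 := by
    intro S hS i hi
    refine (epoch_strictMono hS).lt_iff_lt.1 ?_
    rw [epoch_zero]; exact hi.trans_lt ht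
  by_cases hex : ∃ i, epoch T i ≤ t ∧ t < epoch T (i + 1)
  · obtain ⟨i, hi⟩ := hex
    have hi0 := key hT hi.1
    rw [path_eq hT hi, path_eq hT' (i := i), hX i hi0]
    rwa [← epoch_congr_of_nonpos h hi0.le, ← epoch_congr_of_nonpos h (by lia)]
  · rw [path_eq_zero hex, path_eq_zero]
    rintro ⟨i, hi⟩
    have hi0 := key hT' hi.1
    refine hex ⟨i, ?_⟩
    rwa [epoch_congr_of_nonpos h hi0.le, epoch_congr_of_nonpos h (by lia)]

/-- Just before time `0` the path is in state `X (-1)`. -/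
theorem path_eq_neg_one {X : ℤ → Fin K} {T : ℤ → ℝ} (hT : ∀ i, 0 < T i) {t : ℝ}
    (ht : -T (-1) ≤ t) (ht0 : t < 0) : path X T t = X (-1) :=
  path_eq hT (i := -1) (by
    rw [epoch_neg_one, show (-1 : ℤ) + 1 = 0 by norm_num, epoch_zero]; exact ⟨ht, ht0⟩)

theorem path_eq_of_mem_Ico {X : ℤ → Fin K} {T : ℤ → ℝ} (hT : ∀ i, 0 < T i) {t : ℝ}
    (ht : 0 ≤ t) (ht0 : t < T 0) : path X T t = X 0 :=
  path_eq hT (i := 0) (by rw [epoch_zero, zero_add, epoch_one]; exact ⟨ht, ht0⟩)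

end Path

/-! ### Joint measurability of the path, the work and the area. -/

section Measurability

variable {K : ℕ} [NeZero K] {Ω : Type*} [MeasurableSpace Ω]
  {X : ℤ → Ω → Fin K} {T : ℤ → Ω → ℝ}

theorem measurable_epoch (hT : ∀ i, Measurable (T i)) (i : ℤ) :
    Measurable fun ω => epoch (fun j => T j ω) i :=
  (Finset.measurable_fun_sum _ fun j _ => hT j).sub (Finset.measurable_fun_sum _ fun j _ => hT j)

theorem measurableSet_forall_pos (hT : ∀ i, Measurable (T i)) :
    MeasurableSet {ω | ∀ i, 0 < T i ω} := by
  rw [Set.ofPred_forall]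
  exact MeasurableSet.iInter fun i => measurableSet_lt measurable_const (hT i)

open Classical in
/-- The path of the environment, set to `0` for realisations with a nonpositive sojourn time. -/
def regularPath (X : ℤ → Ω → Fin K) (T : ℤ → Ω → ℝ) (ω : Ω) (t : ℝ) : Fin K :=
  if ∀ i, 0 < T i ω then palmPath X T ω t else 0

theorem regularPath_eq {ω : Ω} (h : ∀ i, 0 < T i ω) : regularPath X T ω = palmPath X T ω := by
  ext t; rw [regularPath, if_pos h]

theorem measurable_regularPath (hX : ∀ i, Measurable (X i)) (hT : ∀ i, Measurable (T i)) :
    Measurable fun p : Ω × ℝ => regularPath X T p.1 p.2 := by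
  refine measurable_to_countable' fun k => ?_
  have hG : MeasurableSet {p : Ω × ℝ | ∀ i, 0 < T i p.1} :=
    measurable_fst (measurableSet_forall_pos hT)
  have hI : ∀ i, MeasurableSet {p : Ω × ℝ | epoch (fun j => T j p.1) i ≤ p.2 ∧
      p.2 < epoch (fun j => T j p.1) (i + 1)} := fun i =>
    (measurableSet_le ((measurable_epoch hT i).comp measurable_fst) measurable_snd).inter
      (measurableSet_lt measurable_snd ((measurable_epoch hT (i + 1)).comp measurable_fst))
  have hk : ∀ i, MeasurableSet {p : Ω × ℝ | X i p.1 = k} := fun i =>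
    ((hX i).comp measurable_fst) (measurableSet_singleton k)
  have : (fun p : Ω × ℝ => regularPath X T p.1 p.2) ⁻¹' {k} =
      ({p : Ω × ℝ | ∀ i, 0 < T i p.1} ∩
        ((⋃ i, {p : Ω × ℝ | epoch (fun j => T j p.1) i ≤ p.2 ∧
          p.2 < epoch (fun j => T j p.1) (i + 1)} ∩ {p : Ω × ℝ | X i p.1 = k}) ∪
        ((⋃ i, {p : Ω × ℝ | epoch (fun j => T j p.1) i ≤ p.2 ∧
          p.2 < epoch (fun j => T j p.1) (i + 1)})ᶜ ∩ {_p : Ω × ℝ | (0 : Fin K) = k}))) ∪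
      ({p : Ω × ℝ | ∀ i, 0 < T i p.1}ᶜ ∩ {_p : Ω × ℝ | (0 : Fin K) = k}) := by
    ext p
    by_cases h : ∀ i, 0 < T i p.1
    · have := path_eq_iff (X := fun i => X i p.1) h p.2 k
      simp only [Set.mem_preimage, Set.mem_singleton_iff, regularPath, if_pos h, palmPath, this]
      simp [h]
    · simp [regularPath, h]
  rw [this]
  exact (hG.inter ((MeasurableSet.iUnion fun i => (hI i).inter (hk i)).union
    ((MeasurableSet.iUnion hI).compl.inter (.const _)))).union (hG.compl.inter (.const _))

end Measurability

namespace Queue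

variable {K : ℕ} (Q : Queue K) {Ω : Type*} [MeasurableSpace Ω]

/-- The interval integral is a difference of two integrals over half-open intervals. Writing these
with indicators moves the variable endpoint into the integrand, where measurability of parametrised
integrals applies. -/
theorem measurable_work_uncurry {γ : Ω → ℝ → Fin K} (hγ : Measurable fun p : Ω × ℝ => γ p.1 p.2) :
    Measurable fun p : Ω × ℝ => Q.work (γ p.1) p.2 := by
  have hb : Measurable fun q : (Ω × ℝ) × ℝ => Q.beta (γ q.1.1 q.2) :=
    measurable_comp_state Q.beta (hγ.comp (measurable_fst.fst.prodMk measurable_snd))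
  have h1 : Measurable fun p : Ω × ℝ =>
      ∫ t, (Set.Ioc p.2 0).indicator (fun t => Q.beta (γ p.1 t)) t := by
    refine (StronglyMeasurable.integral_prod_right' (ν := volume) (f := fun q : (Ω × ℝ) × ℝ =>
      (Set.Ioc q.1.2 0).indicator (fun t => Q.beta (γ q.1.1 t)) q.2) ?_).measurable
    refine (Measurable.indicator (s := {q : (Ω × ℝ) × ℝ | q.2 ∈ Set.Ioc q.1.2 0})
      hb ?_).stronglyMeasurable
    exact (measurableSet_lt measurable_fst.snd measurable_snd).inter
      (measurableSet_le measurable_snd measurable_const)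
  have h2 : Measurable fun p : Ω × ℝ =>
      ∫ t, (Set.Ioc 0 p.2).indicator (fun t => Q.beta (γ p.1 t)) t := by
    refine (StronglyMeasurable.integral_prod_right' (ν := volume) (f := fun q : (Ω × ℝ) × ℝ =>
      (Set.Ioc 0 q.1.2).indicator (fun t => Q.beta (γ q.1.1 t)) q.2) ?_).measurable
    refine (Measurable.indicator (s := {q : (Ω × ℝ) × ℝ | q.2 ∈ Set.Ioc 0 q.1.2})
      hb ?_).stronglyMeasurable
    exact (measurableSet_lt measurable_const measurable_snd).inter
      (measurableSet_le measurable_snd measurable_fst.snd)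
  simp only [integral_indicator measurableSet_Ioc] at h1 h2
  exact h1.sub h2

theorem measurable_area {γ : Ω → ℝ → Fin K} (hγ : Measurable fun p : Ω × ℝ => γ p.1 p.2) :
    Measurable fun ω => Q.area (γ ω) := by
  have hγω : ∀ ω, Measurable (γ ω) := fun ω => hγ.comp measurable_prodMk_left
  simp_rw [Q.area_eq_lintegral (hγω _)]
  refine Measurable.lintegral_prod_right' (ν := volume.restrict (Set.Iio 0))
    (f := fun p : Ω × ℝ => ENNReal.ofReal (Q.lam (γ p.1 p.2)) *
      ENNReal.ofReal (Real.exp (-(Q.mu * Q.work (γ p.1) p.2)))) ?_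
  exact (measurable_comp_state Q.lam hγ).ennreal_ofReal.mul
    ((Q.measurable_work_uncurry hγ).const_mul Q.mu).neg.exp.ennreal_ofReal

end Queue

/-! ### The area as a function of the elapsed sojourn time and the earlier history. -/

section Past

variable {K : ℕ} [NeZero K]

/-- The states of a history `y`, listed backwards in time, extended by `0` after time `0`. -/
def pastState (i : ℤ) (y : ℕ → Fin K × ℝ) : Fin K := if i < 0 then (y (-1 - i).toNat).1 else 0

/-- The sojourn times of a history `y`, listed backwards in time, extended by `1` after
time `0`. -/
def pastSojourn (i : ℤ) (y : ℕ → Fin K × ℝ) : ℝ := if i < 0 then (y (-1 - i).toNat).2 else 1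

theorem measurable_pastState (i : ℤ) : Measurable (pastState (K := K) i) := by
  unfold pastState; split_ifs <;> fun_prop

theorem measurable_pastSojourn (i : ℤ) : Measurable (pastSojourn (K := K) i) := by
  unfold pastSojourn; split_ifs <;> fun_prop

/-- `|A_γ|` as a function of the history of `γ` before time `0`. -/
def Queue.pastArea (Q : Queue K) (y : ℕ → Fin K × ℝ) : ℝ≥0∞ :=
  Q.area (regularPath pastState pastSojourn y)

theorem Queue.measurable_pastArea (Q : Queue K) : Measurable Q.pastArea :=
  Q.measurable_area (measurable_regularPath measurable_pastState measurable_pastSojourn)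

theorem measurable_regularPath_apply {Ω : Type*} [MeasurableSpace Ω] {X : ℤ → Ω → Fin K}
    {T : ℤ → Ω → ℝ} (hX : ∀ i, Measurable (X i)) (hT : ∀ i, Measurable (T i)) (ω : Ω) :
    Measurable (regularPath X T ω) :=
  (measurable_regularPath hX hT).comp measurable_prodMk_left

theorem measurable_path (X : ℤ → Fin K) {T : ℤ → ℝ} (hT : ∀ i, 0 < T i) :
    Measurable (path X T) := by
  have := measurable_regularPath_apply (Ω := Unit) (X := fun i _ => X i) (T := fun i _ => T i)
    (fun _ => measurable_const) (fun _ => measurable_const) ()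
  rwa [regularPath_eq (by exact hT)] at this

theorem Queue.pastArea_le (Q : Queue K) (hρ : ∀ k, Q.beta k = 0 → Q.lam k = 0)
    (y : ℕ → Fin K × ℝ) : Q.pastArea y ≤ ENNReal.ofReal Q.rhoBound :=
  Q.area_le hρ (measurable_regularPath_apply measurable_pastState measurable_pastSojourn y)

/-- The history before the `i`-th transition, listed backwards in time. -/
def history (i : ℤ) (X : ℤ → Fin K) (T : ℤ → ℝ) (n : ℕ) : Fin K × ℝ :=
  (X (i - 1 - n), T (i - 1 - n))

theorem Queue.area_path (Q : Queue K) (X : ℤ → Fin K) {T : ℤ → ℝ} (hT : ∀ i, 0 < T i) :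
    Q.area (path X T) = Q.pastArea (history 0 X T) := by
  -- The filler value `1` after time `0` keeps all sojourn times positive, so that `regularPath`
  -- does not degenerate.
  have hT' : ∀ i, 0 < pastSojourn i (history 0 X T) := fun i => by
    unfold pastSojourn; split_ifs
    · exact hT _
    · exact one_pos
  have hi : ∀ i : ℤ, i < 0 → 0 - 1 - (((-1 - i).toNat : ℕ) : ℤ) = i := fun i hi => by lia
  rw [Queue.pastArea, regularPath_eq hT']
  refine Q.area_congr (measurable_path X hT) (measurable_path _ hT') fun t ht =>
    path_congr_of_neg hT hT' (fun i hi0 => ?_) (fun i hi0 => ?_) ht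
  · simp only [pastState, if_pos hi0, history, hi i hi0]
  · simp only [pastSojourn, if_pos hi0, history, hi i hi0]

/-- `|A_γ|` for a path that has been in state `k` for time `s`, with history `y` before that. -/
def Queue.shiftedArea (Q : Queue K) (k : Fin K) (y : ℕ → Fin K × ℝ) (s : ℝ) : ℝ≥0∞ :=
  ENNReal.ofReal (Q.rho k * (1 - Real.exp (-(Q.muState k * s)))) +
    ENNReal.ofReal (Real.exp (-(Q.muState k * s))) * Q.pastArea y

/-- Together with `area_stat` this expresses `|A_{Γ₀}|` and `|A_Γ|` through the same function
`shiftedArea` of state, history and elapsed time. Here the elapsed time is the whole sojourn `T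
(-1)`; there it is the age `s` of the sojourn that contains the new origin. -/
theorem Queue.area_palm (Q : Queue K) (hρ : ∀ k, Q.beta k = 0 → Q.lam k = 0) (X : ℤ → Fin K)
    {T : ℤ → ℝ} (hT : ∀ i, 0 < T i) :
    Q.area (path X T) = Q.shiftedArea (X (-1)) (history (-1) X T) (T (-1)) := by
  rw [Q.area_shift hρ (measurable_path X hT) (hT (-1)).le fun t ht ht0 =>
    path_eq_neg_one hT ht ht0, Queue.shiftedArea]
  congr 2
  have : history (-1) X T = history 0 (fun i => X (i - 1)) (fun i => T (i - 1)) := by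
    ext n : 1
    simp only [history]
    rw [show (0 : ℤ) - 1 - n - 1 = -1 - 1 - n by ring]
  rw [this, ← Q.area_path _ fun i => hT _]
  simp_rw [← path_shift X hT]

theorem Queue.area_stat (Q : Queue K) (hρ : ∀ k, Q.beta k = 0 → Q.lam k = 0) (X : ℤ → Fin K)
    {T : ℤ → ℝ} (hT : ∀ i, 0 < T i) {s : ℝ} (hs : 0 ≤ s) (hs' : s < T 0) :
    Q.area (fun t => path X T (t + s)) = Q.shiftedArea (X 0) (history 0 X T) s := by
  rw [Q.area_shift (γ := fun t => path X T (t + s)) (k := X 0) hρ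
    ((measurable_path X hT).comp (measurable_add_const s)) hs
    fun t ht ht0 => path_eq_of_mem_Ico hT (by linarith) (by linarith), Queue.shiftedArea]
  simp only [sub_add_cancel, ← Q.area_path X hT]

end Past

/-! ### A π-system for the laws of histories. -/

section Boxes

variable {K : ℕ}

/-- The histories whose last `n` states are given and whose last `n` sojourn times lie in given
sets. -/
def historyBox (n : ℕ) (x : ℕ → Fin K) (B : ℕ → Set ℝ) : Set (ℕ → Fin K × ℝ) :=
  {y | ∀ j < n, (y j).1 = x j ∧ (y j).2 ∈ B j}

variable (K) in
/-- The π-system of all boxes with measurable sides. -/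
def historyBoxes : Set (Set (ℕ → Fin K × ℝ)) :=
  {S | ∃ n x B, (∀ j, MeasurableSet (B j)) ∧ S = historyBox n x B}

theorem measurableSet_historyBox (n : ℕ) (x : ℕ → Fin K) {B : ℕ → Set ℝ}
    (hB : ∀ j, MeasurableSet (B j)) : MeasurableSet (historyBox n x B) := by
  have : historyBox n x B = ⋂ j, ⋂ _ : j < n,
      (fun y : ℕ → Fin K × ℝ => y j) ⁻¹' ({x j} ×ˢ B j) := by
    ext y; simp [historyBox]
  rw [this]
  exact MeasurableSet.iInter fun j => MeasurableSet.iInter fun _ =>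
    measurable_pi_apply j ((measurableSet_singleton _).prod (hB j))

theorem isPiSystem_historyBoxes : IsPiSystem (historyBoxes K) := by
  rintro _ ⟨n, x, B, hB, rfl⟩ _ ⟨m, x', B', hB', rfl⟩ ⟨y, hy, hy'⟩
  -- The common point `y` supplies the states: at each index below `max n m` it agrees with
  -- whichever of `x`, `x'` is prescribed there. Disjoint boxes need no treatment, because a
  -- π-system only concerns nonempty intersections.
  refine ⟨max n m, fun j => (y j).1,
    fun j => (if j < n then B j else Set.univ) ∩ (if j < m then B' j else Set.univ), ?_, ?_⟩
  · intro j
    refine MeasurableSet.inter ?_ ?_ <;> split_ifs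
    exacts [hB j, .univ, hB' j, .univ]
  · ext z
    simp only [historyBox, Set.mem_inter_iff, Set.mem_ofPred_eq] at hy hy' ⊢
    constructor
    · rintro ⟨h1, h2⟩ j hj
      refine ⟨?_, ?_, ?_⟩
      · rcases lt_max_iff.1 hj with h | h
        · rw [(h1 j h).1, (hy j h).1]
        · rw [(h2 j h).1, (hy' j h).1]
      · split_ifs with h
        exacts [(h1 j h).2, Set.mem_univ _]
      · split_ifs with h
        exacts [(h2 j h).2, Set.mem_univ _]
    · intro h
      refine ⟨fun j hj => ?_, fun j hj => ?_⟩
      · obtain ⟨h1, h2, -⟩ := h j (lt_max_of_lt_left hj)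
        rw [if_pos hj] at h2
        exact ⟨h1.trans (hy j hj).1, h2⟩
      · obtain ⟨h1, -, h2⟩ := h j (lt_max_of_lt_right hj)
        rw [if_pos hj] at h2
        exact ⟨h1.trans (hy' j hj).1, h2⟩

theorem generateFrom_historyBoxes [NeZero K] :
    MeasurableSpace.generateFrom (historyBoxes K) = MeasurableSpace.pi := by
  refine le_antisymm (MeasurableSpace.generateFrom_le ?_) (iSup_le fun j => ?_)
  · rintro _ ⟨n, x, B, hB, rfl⟩
    exact measurableSet_historyBox n x hB
  · rintro _ ⟨C, hC, rfl⟩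
    -- A cylinder over `C` is the finite union, over the values of the first `j + 1` states, of the
    -- boxes whose last side is the section of `C` at the last state.
    have : (fun y : ℕ → Fin K × ℝ => y j) ⁻¹' C = ⋃ x : Fin (j + 1) → Fin K,
        historyBox (j + 1) (fun i => if h : i < j + 1 then x ⟨i, h⟩ else 0)
          (fun i => if i = j then {t | (x (Fin.last j), t) ∈ C} else Set.univ) := by
      ext y
      simp only [historyBox, Set.mem_preimage, Set.mem_iUnion, Set.mem_ofPred_eq]
      constructor
      · intro h
        refine ⟨fun i => (y i).1, fun i hi => ⟨by rw [dif_pos hi], ?_⟩⟩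
        split_ifs with hij
        · subst hij; exact h
        · exact Set.mem_univ _
      · rintro ⟨x, hx⟩
        obtain ⟨h1, h2⟩ := hx j (Nat.lt_succ_self j)
        rw [dif_pos (Nat.lt_succ_self j)] at h1
        rw [if_pos rfl] at h2
        have : y j = (x (Fin.last j), (y j).2) := Prod.ext h1 rfl
        rw [this]; exact h2
    rw [this]
    refine MeasurableSet.iUnion fun x => MeasurableSpace.measurableSet_generateFrom
      ⟨_, _, _, fun i => ?_, rfl⟩
    split_ifs
    · exact measurable_prodMk_left hC
    · exact .univ

end Boxes

/-! ### The Palm version: independence of the history and the next sojourn. -/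

namespace Queue

variable {K : ℕ} {Q : Queue K} {π : Fin K → ℝ}

/-- Some state `i` is charged, irreducibility gives an `n` with `(P ^ n) i k > 0`, and `π = π P ^
n`. Positivity makes conditioning on each state meaningful. -/
theorem IsStationary.pos (hπ : Q.IsStationary π) (k : Fin K) : 0 < π k := by
  obtain ⟨i, hi⟩ : ∃ i, 0 < π i := by
    by_contra! h
    have := Finset.sum_nonpos fun i (_ : i ∈ Finset.univ) => h i
    linarith [hπ.sum_eq_one]
  have hP : ∀ i j, 0 ≤ Q.P i j := Q.P_irreducible.nonneg
  obtain ⟨n, -, hn⟩ := (Matrix.isIrreducible_iff_exists_pow_pos hP).1 Q.P_irreducible i k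
  have hinv : Matrix.vecMul π (Q.P ^ n) = π := by
    clear hn
    induction n with
    | zero => simp
    | succ n ih => rw [pow_succ, ← Matrix.vecMul_vecMul, ih, hπ.invariant]
  have hPn : ∀ i j, 0 ≤ (Q.P ^ n) i j := fun i j => Matrix.pow_apply_nonneg hP n i j
  rw [← hinv]
  refine (mul_pos hi hn).trans_le ?_
  exact Finset.single_le_sum (f := fun j => π j * (Q.P ^ n) j k)
    (fun j _ => mul_nonneg (hπ.nonneg j) (hPn j k)) (Finset.mem_univ i)

variable {Ω : Type*} [MeasurableSpace Ω] {ℙ₀ : Measure Ω} {X : ℤ → Ω → Fin K} {T : ℤ → Ω → ℝ}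

namespace IsPalmEnvironment

theorem measure_state_inter (h : Q.IsPalmEnvironment π ℙ₀ X T) (i : ℤ) (k : Fin K) {B : Set ℝ}
    (hB : MeasurableSet B) :
    ℙ₀ {ω | X i ω = k ∧ T i ω ∈ B} = ENNReal.ofReal (π k) * Q.sojourn k B := by
  have := h.law i 0 (fun _ => k) (fun _ => B) fun _ => hB
  simpa using this

theorem measure_state (h : Q.IsPalmEnvironment π ℙ₀ X T) (i : ℤ) (k : Fin K) :
    ℙ₀ {ω | X i ω = k} = ENNReal.ofReal (π k) := by
  have := Q.sojourn_prob k
  simpa using h.measure_state_inter i k MeasurableSet.univ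

theorem ae_pos (h : Q.IsPalmEnvironment π ℙ₀ X T) : ∀ᵐ ω ∂ℙ₀, ∀ i, 0 < T i ω := by
  refine ae_all_iff.2 fun i => ?_
  have : ∀ᵐ ω ∂ℙ₀, ∀ k, ¬(X i ω = k ∧ T i ω ∈ Set.Iic 0) := by
    refine ae_all_iff.2 fun k => ?_
    rw [ae_iff]
    simp only [not_not]
    rw [h.measure_state_inter i k measurableSet_Iic]
    have : Q.sojourn k (Set.Iic 0) = 0 := by
      have := Q.sojourn_pos k
      rw [ae_iff] at this
      simpa only [not_lt] using! this
    rw [this, mul_zero]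
  filter_upwards [this] with ω hω
  exact not_le.1 fun hle => hω _ ⟨rfl, hle⟩

theorem measurable_history (h : Q.IsPalmEnvironment π ℙ₀ X T) (i : ℤ) :
    Measurable fun ω => history i (fun j => X j ω) (fun j => T j ω) :=
  measurable_pi_lambda _ fun _ => (h.measurable_X _).prodMk (h.measurable_T _)

theorem measurableSet_state (h : Q.IsPalmEnvironment π ℙ₀ X T) (i : ℤ) (k : Fin K) :
    MeasurableSet {ω | X i ω = k} := h.measurable_X i (measurableSet_singleton k)

/-- The constant depends neither on `i` nor on `C`: the first expresses stationarity, the second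
that the sojourn starting at the `i`-th transition is independent of the history once the state is
known. -/
theorem measure_historyBox (h : Q.IsPalmEnvironment π ℙ₀ X T) (n : ℕ) (k : Fin K)
    (x : ℕ → Fin K) {B : ℕ → Set ℝ} (hB : ∀ j, MeasurableSet (B j)) :
    ∃ c : ℝ≥0∞, ∀ i C, MeasurableSet C →
      ℙ₀ {ω | history i (fun j => X j ω) (fun j => T j ω) ∈ historyBox n x B ∧
        X i ω = k ∧ T i ω ∈ C} = c * Q.sojourn k C := by
  -- A history runs backwards in time but the law of the environment is given forwards, so the `n`
  -- past states are reversed and followed by `k`; the reading starts at index `i - n`.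
  set x' : ℕ → Fin K := fun j => if j < n then x (n - 1 - j) else k with hx'
  refine ⟨ENNReal.ofReal (π (x' 0) * ∏ j ∈ Finset.range n, Q.P (x' j) (x' (j + 1))) *
    ∏ j ∈ Finset.range n, Q.sojourn (x' j) (B (n - 1 - j)), fun i C hC => ?_⟩
  have key := h.law (i - n) n x' (fun j => if j < n then B (n - 1 - j) else C) fun j => by
    split_ifs
    exacts [hB _, hC]
  rw [Finset.prod_range_succ, ← mul_assoc] at key
  have hk : x' n = k := by simp [hx']
  rw [if_neg (lt_irrefl n), hk] at key
  rw [Finset.prod_congr rfl (g := fun j => Q.sojourn (x' j) (B (n - 1 - j)))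
    fun j hj => by rw [if_pos (Finset.mem_range.1 hj)]] at key
  rw [← key]
  congr 1
  ext ω
  simp only [historyBox, history, Set.mem_ofPred_eq]
  constructor
  · rintro ⟨h1, h2, h3⟩ j hj
    rcases hj.lt_or_eq with hj | rfl
    · have := h1 (n - 1 - j) (by lia)
      rw [show i - 1 - ((n - 1 - j : ℕ) : ℤ) = i - n + j by lia] at this
      simpa only [hx', if_pos hj] using this
    · simpa [hx'] using ⟨h2, h3⟩
  · intro hj
    refine ⟨fun j hjn => ?_, ?_⟩
    · have := hj (n - 1 - j) (by lia)
      have hxj : x' (n - 1 - j) = x j := by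
        simp only [hx']
        rw [if_pos (by lia), show n - 1 - (n - 1 - j) = j by lia]
      rw [if_pos (by lia : n - 1 - j < n), hxj,
        show n - 1 - (n - 1 - j) = j by lia,
        show i - n + ((n - 1 - j : ℕ) : ℤ) = i - 1 - j by lia] at this
      exact this
    · simpa [hx'] using hj n le_rfl

variable (ℙ₀ X T) in
/-- The law of the history before a transition into state `k`, on the event that `X 0 = k`. -/
def _root_.MMInf.historyLaw (k : Fin K) : Measure (ℕ → Fin K × ℝ) :=
  (ℙ₀.restrict {ω | X 0 ω = k}).map fun ω => history 0 (fun j => X j ω) (fun j => T j ω)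

/-- The first factor is the law at index `0` whatever `i` is. This makes the histories behind the
Palm version (`i = -1`) and the stationary version (`i = 0`) comparable. -/
theorem map_history_sojourn [NeZero K] [IsProbabilityMeasure ℙ₀]
    (h : Q.IsPalmEnvironment π ℙ₀ X T) (i : ℤ) (k : Fin K) :
    (ℙ₀.restrict {ω | X i ω = k}).map
      (fun ω => (history i (fun j => X j ω) (fun j => T j ω), T i ω)) =
    (historyLaw ℙ₀ X T k).prod (Q.sojourn k) := by
  have := Q.sojourn_prob k
  have hfin : IsFiniteMeasure (historyLaw ℙ₀ X T k) := by unfold historyLaw; infer_instance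
  symm
  refine Measure.prod_eq_generateFrom (C := historyBoxes K) (D := {s | MeasurableSet s})
    generateFrom_historyBoxes MeasurableSpace.generateFrom_measurableSet isPiSystem_historyBoxes
    MeasurableSpace.isPiSystem_measurableSet
    ⟨fun _ => Set.univ, fun _ => ⟨0, 0, fun _ => Set.univ, fun _ => .univ, by simp [historyBox]⟩,
      fun _ => measure_lt_top _ _, Set.iUnion_const _⟩
    (Measure.toFiniteSpanningSetsIn _) ?_
  rintro _ ⟨n, x, B, hB, rfl⟩ C hC
  replace hC : MeasurableSet C := hC
  have hbox := measurableSet_historyBox n x hB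
  obtain ⟨c, hc⟩ := h.measure_historyBox n k x hB
  rw [Measure.map_apply ((h.measurable_history i).prodMk (h.measurable_T i)) (hbox.prod hC),
    Measure.restrict_apply
      (((h.measurable_history i).prodMk (h.measurable_T i)) (hbox.prod hC)),
    historyLaw, Measure.map_apply (h.measurable_history 0) hbox,
    Measure.restrict_apply ((h.measurable_history 0) hbox)]
  have h1 := hc i C hC
  -- With `C` the whole line and `i = 0`, the constant `c` is identified as the mass that
  -- `historyLaw` gives to the box.
  have h2 := hc 0 Set.univ .univ
  rw [measure_univ, mul_one] at h2
  rw [← h2] at h1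
  convert! h1 using 2
  · ext ω
    simp only [Set.mem_inter_iff, Set.mem_preimage, Set.mem_prod, Set.mem_ofPred_eq]
    tauto
  · congr 1
    ext ω
    simp

theorem historyLaw_univ (h : Q.IsPalmEnvironment π ℙ₀ X T) (k : Fin K) :
    historyLaw ℙ₀ X T k Set.univ = ENNReal.ofReal (π k) := by
  rw [historyLaw, Measure.map_apply (h.measurable_history 0) .univ]
  simp [h.measure_state]

end IsPalmEnvironment

end Queue

theorem cond_congr_set {α : Type*} [MeasurableSpace α] {μ : Measure α} {s t : Set α}
    (h : s =ᵐ[μ] t) : ProbabilityTheory.cond μ s = ProbabilityTheory.cond μ t := by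
  rw [ProbabilityTheory.cond, ProbabilityTheory.cond, measure_congr h, Measure.restrict_congr_set h]

/-! ### The residual law and the alternating binomial sum of moments. -/

namespace Queue

variable {K : ℕ} (Q : Queue K)

theorem lintegral_sojourn_id (k : Fin K) :
    ∫⁻ x, ENNReal.ofReal x ∂(Q.sojourn k) = ENNReal.ofReal (Q.meanSojourn k) :=
  (ofReal_integral_eq_lintegral_ofReal (Q.sojourn_integrable k)
    ((Q.sojourn_pos k).mono fun _ h => h.le)).symm

theorem meanSojourn_pos (k : Fin K) : 0 < Q.meanSojourn k := by
  have := Q.sojourn_prob k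
  rw [meanSojourn, integral_pos_iff_support_of_nonneg_ae
    ((Q.sojourn_pos k).mono fun _ h => h.le) (Q.sojourn_integrable k)]
  have : Q.sojourn k (Function.support fun x : ℝ => x) = 1 := by
    rw [← measure_univ (μ := Q.sojourn k)]
    refine measure_congr ((Q.sojourn_pos k).mono fun x hx => ?_)
    exact propext ⟨fun _ => trivial, fun _ => hx.ne'⟩
  rw [this]; exact one_pos

/-- Choosing a time uniformly in a sojourn interval leads to the residual law. -/
theorem lintegral_lintegral_Ico (k : Fin K) {g : ℝ → ℝ≥0∞} (hg : Measurable g) :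
    ∫⁻ t, (∫⁻ s in Set.Ico 0 t, g s) ∂(Q.sojourn k) =
      ENNReal.ofReal (Q.meanSojourn k) * ∫⁻ s, g s ∂(Q.residual k) := by
  have := Q.sojourn_prob k
  have hm := Q.meanSojourn_pos k
  have hmeas : Measurable fun s => Q.sojourn k (Set.Ioi s) :=
    Antitone.measurable fun a b hab => measure_mono (Set.Ioi_subset_Ioi hab)
  have hd : Measurable fun x => ENNReal.ofReal ((Q.sojourn k).real (Set.Ioi x) / Q.meanSojourn k) :=
    (hmeas.ennreal_toReal.div_const _).ennreal_ofReal
  have h1 : ∀ t : ℝ, ∫⁻ s in Set.Ico 0 t, g s =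
      ∫⁻ s in Set.Ici 0, (Set.Ioi s).indicator (fun _ => g s) t := by
    intro t
    rw [← lintegral_indicator measurableSet_Ico, ← lintegral_indicator measurableSet_Ici]
    refine lintegral_congr fun s => ?_
    by_cases h0 : 0 ≤ s <;> by_cases ht : s < t <;> simp [Set.indicator, h0, ht]
  simp_rw [h1]
  rw [lintegral_lintegral_swap]
  · rw [residual, lintegral_withDensity_eq_lintegral_mul _ hd hg,
      ← lintegral_const_mul' _ _ ENNReal.ofReal_ne_top, setLIntegral_congr Ioi_ae_eq_Ici.symm]
    refine lintegral_congr fun s => ?_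
    rw [lintegral_indicator_const measurableSet_Ioi, Pi.mul_apply, ← mul_assoc,
      ← ENNReal.ofReal_mul hm.le, mul_div_cancel₀ _ hm.ne', ofReal_measureReal, mul_comm]
  · refine Measurable.aemeasurable ?_
    exact (hg.comp measurable_snd).indicator (s := {p : ℝ × ℝ | p.2 < p.1})
      (measurableSet_lt measurable_snd measurable_fst)

/-- For the integrand `1` the preceding identity says that `E[T_k]` is `E[T_k]` times the total
mass, and `E[T_k]` is positive and finite. -/
theorem isProbabilityMeasure_residual (k : Fin K) : IsProbabilityMeasure (Q.residual k) := by
  have h := Q.lintegral_lintegral_Ico k (g := fun _ => 1) measurable_const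
  simp only [lintegral_one, Measure.restrict_apply_univ, Real.volume_Ico, sub_zero,
    lintegral_sojourn_id] at h
  have hm : ENNReal.ofReal (Q.meanSojourn k) ≠ 0 := by simpa using Q.meanSojourn_pos k
  exact ⟨(ENNReal.mul_right_inj hm ENNReal.ofReal_ne_top).1 (by rw [← h, mul_one])⟩

theorem residual_nonneg (k : Fin K) : ∀ᵐ x ∂(Q.residual k), 0 ≤ x := by
  refine (withDensity_absolutelyContinuous _ _).ae_le ?_
  exact (ae_restrict_mem measurableSet_Ioi).mono fun x hx => le_of_lt hx

section Binomial

variable [NeZero K]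

theorem measurable_shiftedArea (k : Fin K) :
    Measurable fun p : (ℕ → Fin K × ℝ) × ℝ => Q.shiftedArea k p.1 p.2 := by
  have := Q.measurable_pastArea
  unfold shiftedArea
  fun_prop

-- In this form `ρ_k - |A|` is a function of the elapsed time multiplied by a function of the
-- history. Its `n`-th power keeps the product structure, which the powers of `|A|` itself lack.
variable {Q} in
theorem toReal_shiftedArea (hρ : ∀ k, Q.beta k = 0 → Q.lam k = 0) (k : Fin K)
    (y : ℕ → Fin K × ℝ) {s : ℝ} (hs : 0 ≤ s) : (Q.shiftedArea k y s).toReal =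
      Q.rho k - Real.exp (-(Q.muState k * s)) * (Q.rho k - (Q.pastArea y).toReal) := by
  have hy : Q.pastArea y ≠ ∞ := ((Q.pastArea_le hρ y).trans_lt ENNReal.ofReal_lt_top).ne
  have hexp : Real.exp (-(Q.muState k * s)) ≤ 1 :=
    Real.exp_le_one_iff.2 (neg_nonpos.2 (mul_nonneg (Q.muState_nonneg k) hs))
  rw [shiftedArea, ENNReal.toReal_add ENNReal.ofReal_ne_top
    (ENNReal.mul_ne_top ENNReal.ofReal_ne_top hy), ENNReal.toReal_mul,
    ENNReal.toReal_ofReal (mul_nonneg (Q.rho_nonneg k) (by linarith)),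
    ENNReal.toReal_ofReal (Real.exp_pos _).le]
  ring

variable {Q} in
theorem shiftedArea_le (hρ : ∀ k, Q.beta k = 0 → Q.lam k = 0) (k : Fin K)
    (y : ℕ → Fin K × ℝ) {s : ℝ} (hs : 0 ≤ s) :
    Q.shiftedArea k y s ≤ ENNReal.ofReal (Q.rhoBound + Q.rhoBound) := by
  have hexp : Real.exp (-(Q.muState k * s)) ≤ 1 :=
    Real.exp_le_one_iff.2 (neg_nonpos.2 (mul_nonneg (Q.muState_nonneg k) hs))
  rw [shiftedArea, ENNReal.ofReal_add Q.rhoBound_nonneg Q.rhoBound_nonneg]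
  refine add_le_add (ENNReal.ofReal_le_ofReal ?_) ?_
  · refine le_trans ?_ (Q.rho_le_rhoBound k)
    exact mul_le_of_le_one_right (Q.rho_nonneg k) (by linarith [Real.exp_pos (-(Q.muState k * s))])
  · refine le_trans ?_ (Q.pastArea_le hρ y)
    exact mul_le_of_le_one_left' (ENNReal.ofReal_le_one.2 hexp)

variable {Q} in
/-- The alternating binomial sum of the moments of `|A|` splits into a Laplace transform of the
time `θ` spent in the last state and a factor that only depends on the history `η`. -/
theorem binomial_moments (hρ : ∀ k, Q.beta k = 0 → Q.lam k = 0) (k : Fin K)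
    (η : Measure (ℕ → Fin K × ℝ)) [IsProbabilityMeasure η] (θ : Measure ℝ)
    [IsProbabilityMeasure θ] (hθ : ∀ᵐ s ∂θ, 0 ≤ s) (n : ℕ) :
    ∑ j ∈ Finset.range (n + 1), (-1 : ℝ) ^ j * (n.choose j : ℝ) * (Q.rho k ^ (n - j) *
      (∫⁻ p, Q.shiftedArea k p.1 p.2 ^ j ∂(η.prod θ)).toReal) =
    (∫ s, Real.exp (-((n : ℝ) * Q.muState k) * s) ∂θ) *
      ∫ y, (Q.rho k - (Q.pastArea y).toReal) ^ n ∂η := by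
  have hθ' : ∀ᵐ p ∂(η.prod θ), 0 ≤ p.2 := Measure.quasiMeasurePreserving_snd.ae hθ
  have hmeas := Q.measurable_shiftedArea k
  have hreal : ∀ j : ℕ, (∫⁻ p, Q.shiftedArea k p.1 p.2 ^ j ∂(η.prod θ)).toReal =
      ∫ p, (Q.shiftedArea k p.1 p.2).toReal ^ j ∂(η.prod θ) := by
    intro j
    rw [← integral_toReal (hmeas.pow_const j).aemeasurable]
    · simp only [ENNReal.toReal_pow]
    · filter_upwards [hθ'] with p hp
      exact ENNReal.pow_lt_top ((shiftedArea_le hρ k p.1 hp).trans_lt ENNReal.ofReal_lt_top)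
  have hint : ∀ j : ℕ, Integrable (fun p => (Q.shiftedArea k p.1 p.2).toReal ^ j) (η.prod θ) := by
    intro j
    refine Integrable.of_bound (hmeas.ennreal_toReal.pow_const j).aestronglyMeasurable
      ((Q.rhoBound + Q.rhoBound) ^ j) ?_
    filter_upwards [hθ'] with p hp
    rw [Real.norm_of_nonneg (by positivity)]
    exact pow_le_pow_left₀ ENNReal.toReal_nonneg (ENNReal.toReal_le_of_le_ofReal
      (add_nonneg Q.rhoBound_nonneg Q.rhoBound_nonneg) (shiftedArea_le hρ k p.1 hp)) j
  have hsum : ∀ j : ℕ, (-1 : ℝ) ^ j * (n.choose j : ℝ) * (Q.rho k ^ (n - j) *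
      ∫ p, (Q.shiftedArea k p.1 p.2).toReal ^ j ∂(η.prod θ)) =
      ∫ p, (-1 : ℝ) ^ j * (n.choose j : ℝ) * (Q.rho k ^ (n - j) *
        (Q.shiftedArea k p.1 p.2).toReal ^ j) ∂(η.prod θ) := fun j => by
    rw [integral_const_mul, integral_const_mul]
  simp_rw [hreal, hsum]
  rw [← integral_finsetSum _ fun j _ => ((hint j).const_mul _).const_mul _, mul_comm,
    ← integral_prod_mul (μ := η) (ν := θ) (fun y => (Q.rho k - (Q.pastArea y).toReal) ^ n)
      (fun s => Real.exp (-((n : ℝ) * Q.muState k) * s))]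
  refine integral_congr_ae ?_
  filter_upwards [hθ'] with p hp
  have hexp : Real.exp (-((n : ℝ) * Q.muState k) * p.2) =
      Real.exp (-(Q.muState k * p.2)) ^ n := by
    rw [← Real.exp_nat_mul]; congr 1; ring
  have hA := toReal_shiftedArea hρ k p.1 hp
  set A := (Q.shiftedArea k p.1 p.2).toReal
  set e := Real.exp (-(Q.muState k * p.2))
  set G := (Q.pastArea p.1).toReal
  -- The binomial theorem is applied to `-A + ρ_k`, so that the powers of `A` carry the alternating
  -- signs.
  have : (Q.rho k - G) ^ n * e ^ n = (-A + Q.rho k) ^ n := by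
    rw [← mul_pow, hA]; congr 1; ring
  rw [hexp, this, add_pow]
  refine Finset.sum_congr rfl fun j _ => ?_
  rw [neg_pow]; ring

end Binomial

/-! ### The moments of `|A_{Γ₀}|` and `|A_Γ|`, and the relations between them. -/

variable {Q} [NeZero K] {π : Fin K → ℝ} {Ω : Type*} [MeasurableSpace Ω] {ℙ₀ : Measure Ω}
  [IsProbabilityMeasure ℙ₀] {X : ℤ → Ω → Fin K} {T : ℤ → Ω → ℝ}

namespace IsPalmEnvironment

variable (ℙ₀ X T π) in
/-- The conditional law of the history before a transition into state `k`. -/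
def _root_.MMInf.condHistoryLaw (k : Fin K) : Measure (ℕ → Fin K × ℝ) :=
  (ENNReal.ofReal (π k))⁻¹ • historyLaw ℙ₀ X T k

theorem isProbabilityMeasure_condHistoryLaw (h : Q.IsPalmEnvironment π ℙ₀ X T)
    (hπ : Q.IsStationary π) (k : Fin K) :
    IsProbabilityMeasure (condHistoryLaw π ℙ₀ X T k) := by
  refine ⟨?_⟩
  rw [condHistoryLaw, Measure.smul_apply, h.historyLaw_univ, smul_eq_mul]
  exact ENNReal.inv_mul_cancel (by simpa using hπ.pos k) ENNReal.ofReal_ne_top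

theorem palmMoment_eq (h : Q.IsPalmEnvironment π ℙ₀ X T)
    (hρ : ∀ k, Q.beta k = 0 → Q.lam k = 0) (n : ℕ) (k : Fin K) :
    palmMoment Q ℙ₀ X T n k =
      ∫⁻ p, Q.shiftedArea k p.1 p.2 ^ n ∂((condHistoryLaw π ℙ₀ X T k).prod (Q.sojourn k)) := by
  have := Q.sojourn_prob k
  have hS := h.measurableSet_state (-1) k
  rw [palmMoment, ProbabilityTheory.cond, h.measure_state, lintegral_smul_measure,
    condHistoryLaw, Measure.prod_smul_left, lintegral_smul_measure,
    ← h.map_history_sojourn (-1) k, lintegral_map ((Q.measurable_shiftedArea k).pow_const n)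
      ((h.measurable_history _).prodMk (h.measurable_T _))]
  congr 1
  refine setLIntegral_congr_fun_ae hS ?_
  filter_upwards [h.ae_pos] with ω hω hk
  have hk' : X (-1) ω = k := hk
  rw [palmPath, Q.area_palm hρ _ hω, hk']

/-- The pairs of an outcome and a point of the sojourn interval that starts at time `0`. -/
def _root_.MMInf.sojournGraph (T : ℤ → Ω → ℝ) : Set (Ω × ℝ) := {z | 0 ≤ z.2 ∧ z.2 < T 0 z.1}

theorem measurableSet_sojournGraph (h : Q.IsPalmEnvironment π ℙ₀ X T) :
    MeasurableSet (sojournGraph T) :=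
  (measurableSet_le measurable_const measurable_snd).inter
    (measurableSet_lt measurable_snd ((h.measurable_T 0).comp measurable_fst))

theorem measurableSet_fst_state (h : Q.IsPalmEnvironment π ℙ₀ X T) (k : Fin K) :
    MeasurableSet {z : Ω × ℝ | X 0 z.1 = k} :=
  measurable_fst (h.measurableSet_state 0 k)

/-- This is Palm inversion on the event `X 0 = k`. The history is independent of the sojourn length
`T 0`, so for each history a uniform point of `[0, T 0)` may be replaced by a residual time with
weight `E[T_k]` (`lintegral_lintegral_Ico`). -/
theorem setLIntegral_sojournGraph (h : Q.IsPalmEnvironment π ℙ₀ X T) (k : Fin K)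
    {f : (ℕ → Fin K × ℝ) × ℝ → ℝ≥0∞} (hf : Measurable f) :
    ∫⁻ z in sojournGraph T ∩ {z | X 0 z.1 = k},
      f (history 0 (fun j => X j z.1) (fun j => T j z.1), z.2) ∂(ℙ₀.prod volume) =
    ENNReal.ofReal (Q.meanSojourn k) *
      ∫⁻ p, f p ∂((historyLaw ℙ₀ X T k).prod (Q.residual k)) := by
  have := Q.sojourn_prob k
  have := Q.isProbabilityMeasure_residual k
  have hfin : IsFiniteMeasure (historyLaw ℙ₀ X T k) := by unfold historyLaw; infer_instance
  have hS := h.measurableSet_state 0 k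
  have hD := h.measurableSet_sojournGraph
  have hf' : Measurable fun z : Ω × ℝ =>
      f (history 0 (fun j => X j z.1) (fun j => T j z.1), z.2) :=
    hf.comp (((h.measurable_history 0).comp measurable_fst).prodMk measurable_snd)
  have hg : Measurable fun p : (ℕ → Fin K × ℝ) × ℝ => ∫⁻ s in Set.Ico 0 p.2, f (p.1, s) := by
    simp_rw [← lintegral_indicator measurableSet_Ico]
    refine Measurable.lintegral_prod_right' (ν := volume)
      (f := fun q : ((ℕ → Fin K × ℝ) × ℝ) × ℝ =>
        (Set.Ico 0 q.1.2).indicator (fun s => f (q.1.1, s)) q.2) ?_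
    exact Measurable.indicator (s := {q : ((ℕ → Fin K × ℝ) × ℝ) × ℝ | q.2 ∈ Set.Ico 0 q.1.2})
      (hf.comp (measurable_fst.fst.prodMk measurable_snd))
      ((measurableSet_le measurable_const measurable_snd).inter
        (measurableSet_lt measurable_snd measurable_fst.snd))
  rw [← lintegral_indicator (hD.inter (h.measurableSet_fst_state k)),
    lintegral_prod _ (hf'.indicator (hD.inter (h.measurableSet_fst_state k))).aemeasurable]
  have h1 : ∀ ω, ∫⁻ s, (sojournGraph T ∩ {z | X 0 z.1 = k}).indicator (fun z : Ω × ℝ =>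
      f (history 0 (fun j => X j z.1) (fun j => T j z.1), z.2)) (ω, s) =
      {ω | X 0 ω = k}.indicator (fun ω => ∫⁻ s in Set.Ico 0 (T 0 ω),
        f (history 0 (fun j => X j ω) (fun j => T j ω), s)) ω := by
    intro ω
    by_cases hk : X 0 ω = k
    · rw [Set.indicator_of_mem (by exact hk), ← lintegral_indicator measurableSet_Ico]
      refine lintegral_congr fun s => ?_
      simp [Set.indicator, sojournGraph, hk]
    · rw [Set.indicator_of_notMem (by exact hk)]
      simp [Set.indicator, hk]
  simp_rw [h1]
  rw [lintegral_indicator hS]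
  have h2 := lintegral_map (μ := ℙ₀.restrict {ω | X 0 ω = k}) hg
    ((h.measurable_history 0).prodMk (h.measurable_T 0))
  rw [← h2, h.map_history_sojourn 0 k, lintegral_prod _ hg.aemeasurable,
    lintegral_prod _ hf.aemeasurable, ← lintegral_const_mul' _ _ ENNReal.ofReal_ne_top]
  exact lintegral_congr fun y => Q.lintegral_lintegral_Ico k
    (g := fun s => f (y, s)) (hf.comp measurable_prodMk_left)

theorem measure_sojournGraph_inter (h : Q.IsPalmEnvironment π ℙ₀ X T) (k : Fin K) :
    (ℙ₀.prod volume) (sojournGraph T ∩ {z | X 0 z.1 = k}) =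
      ENNReal.ofReal (Q.meanSojourn k) * ENNReal.ofReal (π k) := by
  have := Q.isProbabilityMeasure_residual k
  have hfin : IsFiniteMeasure (historyLaw ℙ₀ X T k) := by unfold historyLaw; infer_instance
  have := h.setLIntegral_sojournGraph k (f := fun _ => 1) measurable_const
  rw [setLIntegral_one, lintegral_one, ← Set.univ_prod_univ, Measure.prod_prod,
    measure_univ (μ := Q.residual k), mul_one, h.historyLaw_univ] at this
  exact this

theorem setLIntegral_sojournGraph_eq_sum (h : Q.IsPalmEnvironment π ℙ₀ X T)
    (f : Ω × ℝ → ℝ≥0∞) : ∫⁻ z in sojournGraph T, f z ∂(ℙ₀.prod volume) =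
      ∑ k, ∫⁻ z in sojournGraph T ∩ {z | X 0 z.1 = k}, f z ∂(ℙ₀.prod volume) := by
  have : sojournGraph T = ⋃ k ∈ (Finset.univ : Finset (Fin K)),
      sojournGraph T ∩ {z | X 0 z.1 = k} := by
    ext z; simp
  conv_lhs => rw [this]
  refine lintegral_biUnion_finset (fun i _ j _ hij => ?_) (fun k _ =>
    h.measurableSet_sojournGraph.inter (h.measurableSet_fst_state k)) f
  refine Set.disjoint_left.2 fun z hz hz' => hij ?_
  exact hz.2.symm.trans hz'.2

theorem measure_sojournGraph (h : Q.IsPalmEnvironment π ℙ₀ X T) (hπ : Q.IsStationary π) :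
    (ℙ₀.prod volume) (sojournGraph T) = ENNReal.ofReal (∑ k, π k * Q.meanSojourn k) := by
  have := h.setLIntegral_sojournGraph_eq_sum fun _ => 1
  simp only [setLIntegral_one, h.measure_sojournGraph_inter] at this
  rw [this, ENNReal.ofReal_sum_of_nonneg fun k _ =>
    mul_nonneg (hπ.nonneg k) (Q.meanSojourn_pos k).le]
  refine Finset.sum_congr rfl fun k _ => ?_
  rw [mul_comm, ENNReal.ofReal_mul (hπ.nonneg k)]

theorem _root_.MMInf.Queue.IsStationary.sum_pos (hπ : Q.IsStationary π) :
    0 < ∑ k, π k * Q.meanSojourn k :=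
  Finset.sum_pos (fun k _ => mul_pos (hπ.pos k) (Q.meanSojourn_pos k)) ⟨0, Finset.mem_univ _⟩

theorem isProbabilityMeasure_stationaryLaw (h : Q.IsPalmEnvironment π ℙ₀ X T)
    (hπ : Q.IsStationary π) : IsProbabilityMeasure (stationaryLaw ℙ₀ T) := by
  have hD := h.measure_sojournGraph hπ
  refine cond_isProbabilityMeasure_of_finite ?_ ?_
  · change (ℙ₀.prod volume) (sojournGraph T) ≠ 0
    rw [hD]; simpa using hπ.sum_pos
  · change (ℙ₀.prod volume) (sojournGraph T) ≠ ∞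
    rw [hD]; exact ENNReal.ofReal_ne_top

theorem ae_stationaryLaw (h : Q.IsPalmEnvironment π ℙ₀ X T) :
    ∀ᵐ z ∂(stationaryLaw ℙ₀ T), (∀ i, 0 < T i z.1) ∧ 0 ≤ z.2 ∧ z.2 < T 0 z.1 := by
  have h1 : ∀ᵐ z ∂(ℙ₀.prod (volume : Measure ℝ)), ∀ i, 0 < T i z.1 :=
    Measure.quasiMeasurePreserving_fst.ae h.ae_pos
  have h2 : ∀ᵐ z ∂(stationaryLaw ℙ₀ T), z ∈ sojournGraph T :=
    ae_cond_mem h.measurableSet_sojournGraph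
  filter_upwards [cond_absolutelyContinuous.ae_le h1, h2] with z hz1 hz2
  exact ⟨hz1, hz2⟩

/-- The new origin lies in the sojourn starting at `0`, so `Γ(0) = X 0` almost surely; two
successive conditionings are then merged into one. -/
theorem cond_stationaryLaw (h : Q.IsPalmEnvironment π ℙ₀ X T) (hπ : Q.IsStationary π)
    (k : Fin K) : ProbabilityTheory.cond (stationaryLaw ℙ₀ T) {z | statPath X T z 0 = k} =
      ProbabilityTheory.cond (ℙ₀.prod volume) (sojournGraph T ∩ {z | X 0 z.1 = k}) := by
  have hae : {z | statPath X T z 0 = k} =ᵐ[stationaryLaw ℙ₀ T] {z | X 0 z.1 = k} := by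
    filter_upwards [h.ae_stationaryLaw] with z ⟨hz, hz0, hzT⟩
    change (statPath X T z 0 = k) = (X 0 z.1 = k)
    rw [statPath, zero_add, palmPath, path_eq_of_mem_Ico hz hz0 hzT]
  rw [cond_congr_set hae]
  exact cond_cond_eq_cond_inter' h.measurableSet_sojournGraph (h.measurableSet_fst_state k)
    (by change (ℙ₀.prod volume) (sojournGraph T) ≠ ∞
        rw [h.measure_sojournGraph hπ]; exact ENNReal.ofReal_ne_top)

theorem setLIntegral_area (h : Q.IsPalmEnvironment π ℙ₀ X T)
    (hρ : ∀ k, Q.beta k = 0 → Q.lam k = 0) (n : ℕ) (k : Fin K) :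
    ∫⁻ z in sojournGraph T ∩ {z | X 0 z.1 = k}, Q.area (statPath X T z) ^ n ∂(ℙ₀.prod volume) =
    ENNReal.ofReal (Q.meanSojourn k) * ∫⁻ p, Q.shiftedArea k p.1 p.2 ^ n
      ∂((historyLaw ℙ₀ X T k).prod (Q.residual k)) := by
  rw [← h.setLIntegral_sojournGraph k ((Q.measurable_shiftedArea k).pow_const n)]
  refine setLIntegral_congr_fun_ae
    (h.measurableSet_sojournGraph.inter (h.measurableSet_fst_state k)) ?_
  have h1 : ∀ᵐ z ∂(ℙ₀.prod (volume : Measure ℝ)), ∀ i, 0 < T i z.1 :=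
    Measure.quasiMeasurePreserving_fst.ae h.ae_pos
  filter_upwards [h1] with z hz hzk
  have hk : X 0 z.1 = k := hzk.2
  have := Q.area_stat hρ (fun j => X j z.1) hz hzk.1.1 hzk.1.2
  rw [hk] at this
  rw [← this]
  rfl

/-- The conditioning event has mass `π_k E[T_k]`. The factor `E[T_k]` cancels and `π_k` normalises
the law of the history, leaving the same conditional history law as in `palmMoment_eq`. -/
theorem statMoment_eq (h : Q.IsPalmEnvironment π ℙ₀ X T) (hπ : Q.IsStationary π)
    (hρ : ∀ k, Q.beta k = 0 → Q.lam k = 0) (n : ℕ) (k : Fin K) :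
    statMoment Q ℙ₀ X T n k =
      ∫⁻ p, Q.shiftedArea k p.1 p.2 ^ n ∂((condHistoryLaw π ℙ₀ X T k).prod (Q.residual k)) := by
  have := Q.isProbabilityMeasure_residual k
  have hm : ENNReal.ofReal (Q.meanSojourn k) ≠ 0 := by simpa using Q.meanSojourn_pos k
  rw [statMoment, h.cond_stationaryLaw hπ, ProbabilityTheory.cond, lintegral_smul_measure,
    h.setLIntegral_area hρ, h.measure_sojournGraph_inter, condHistoryLaw, Measure.prod_smul_left,
    lintegral_smul_measure, smul_eq_mul, smul_eq_mul,
    ENNReal.mul_inv (Or.inl hm) (Or.inl ENNReal.ofReal_ne_top), mul_right_comm, ← mul_assoc,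
    ENNReal.inv_mul_cancel hm ENNReal.ofReal_ne_top, one_mul, mul_comm]

theorem totalMoment_eq (h : Q.IsPalmEnvironment π ℙ₀ X T) (hπ : Q.IsStationary π)
    (hρ : ∀ k, Q.beta k = 0 → Q.lam k = 0) (n : ℕ) :
    totalMoment Q ℙ₀ X T n =
      ∑ k, ENNReal.ofReal (Q.timeDist π k) * statMoment Q ℙ₀ X T n k := by
  have hs := hπ.sum_pos
  have hst : stationaryLaw ℙ₀ T = ProbabilityTheory.cond (ℙ₀.prod volume) (sojournGraph T) := rfl
  rw [totalMoment, hst, ProbabilityTheory.cond, lintegral_smul_measure,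
    h.setLIntegral_sojournGraph_eq_sum, h.measure_sojournGraph hπ, smul_eq_mul, Finset.mul_sum]
  refine Finset.sum_congr rfl fun k _ => ?_
  have := Q.isProbabilityMeasure_residual k
  have hp : ENNReal.ofReal (π k) ≠ 0 := by simpa using hπ.pos k
  rw [h.setLIntegral_area hρ, h.statMoment_eq hπ hρ, condHistoryLaw, Measure.prod_smul_left,
    lintegral_smul_measure, smul_eq_mul, timeDist, ENNReal.ofReal_div_of_pos hs,
    ENNReal.ofReal_mul (hπ.nonneg k), ENNReal.div_eq_inv_mul, mul_assoc, mul_assoc,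
    mul_left_comm _ (ENNReal.ofReal (π k))⁻¹, ← mul_assoc (ENNReal.ofReal (π k)),
    ENNReal.mul_inv_cancel hp ENNReal.ofReal_ne_top, one_mul]

theorem palmMoment_ne_top (h : Q.IsPalmEnvironment π ℙ₀ X T) (hπ : Q.IsStationary π)
    (hρ : ∀ k, Q.beta k = 0 → Q.lam k = 0) (n : ℕ) (k : Fin K) :
    palmMoment Q ℙ₀ X T n k ≠ ∞ := by
  have := Q.sojourn_prob k
  have := h.isProbabilityMeasure_condHistoryLaw hπ k
  rw [h.palmMoment_eq hρ]
  refine ((lintegral_mono_ae (g := fun _ => ENNReal.ofReal (Q.rhoBound + Q.rhoBound) ^ n)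
    ?_).trans_lt ?_).ne
  · filter_upwards [Measure.quasiMeasurePreserving_snd.ae (Q.sojourn_pos k)] with p hp
    exact pow_le_pow_left' (shiftedArea_le hρ k p.1 hp.le) n
  · rw [lintegral_const, measure_univ, mul_one]
    exact ENNReal.pow_lt_top ENNReal.ofReal_lt_top

theorem statMoment_ne_top (h : Q.IsPalmEnvironment π ℙ₀ X T) (hπ : Q.IsStationary π)
    (hρ : ∀ k, Q.beta k = 0 → Q.lam k = 0) (n : ℕ) (k : Fin K) :
    statMoment Q ℙ₀ X T n k ≠ ∞ := by
  have := Q.isProbabilityMeasure_residual k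
  have := h.isProbabilityMeasure_condHistoryLaw hπ k
  rw [h.statMoment_eq hπ hρ]
  refine ((lintegral_mono_ae (g := fun _ => ENNReal.ofReal (Q.rhoBound + Q.rhoBound) ^ n)
    ?_).trans_lt ?_).ne
  · filter_upwards [Measure.quasiMeasurePreserving_snd.ae (Q.residual_nonneg k)] with p hp
    exact pow_le_pow_left' (shiftedArea_le hρ k p.1 hp) n
  · rw [lintegral_const, measure_univ, mul_one]
    exact ENNReal.pow_lt_top ENNReal.ofReal_lt_top

/-- Positivity permits the cancellation of `τ_k(n μ_k)`, the denominator in `E_n`. -/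
theorem tau_pos (Q : Queue K) (k : Fin K) {s : ℝ} (hs : 0 ≤ s) : 0 < Q.tau k s := by
  have := Q.sojourn_prob k
  refine integral_exp_pos ?_
  refine Integrable.of_bound (by fun_prop) 1 ?_
  filter_upwards [Q.sojourn_pos k] with x hx
  rw [Real.norm_of_nonneg (Real.exp_pos _).le, Real.exp_le_one_iff]
  nlinarith [mul_nonneg hs hx.le]

/-- All matrices are diagonal, so the relation is checked in each state `k`. By `binomial_moments`
the stationary sum is `τ*_k(nμ_k) h` and the Palm sum is `τ_k(nμ_k) h` with the same `h`, and `E_n`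
is the quotient of the two transforms. -/
theorem implicit_relation (h : Q.IsPalmEnvironment π ℙ₀ X T) (hπ : Q.IsStationary π)
    (hρ : ∀ k, Q.beta k = 0 → Q.lam k = 0) (n : ℕ) :
    ∑ j ∈ Finset.range (n + 1), ((-1 : ℝ) ^ j * (n.choose j : ℝ)) •
      Matrix.mulVec (Q.R ^ (n - j))
        (statVec Q ℙ₀ X T j - Matrix.mulVec (Q.E n) (palmVec Q ℙ₀ X T j)) = 0 := by
  ext k
  have := Q.sojourn_prob k
  have := Q.isProbabilityMeasure_residual k
  have := h.isProbabilityMeasure_condHistoryLaw hπ k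
  have h1 := binomial_moments hρ k (condHistoryLaw π ℙ₀ X T k) (Q.residual k)
    (Q.residual_nonneg k) n
  have h2 := binomial_moments hρ k (condHistoryLaw π ℙ₀ X T k) (Q.sojourn k)
    ((Q.sojourn_pos k).mono fun _ h => h.le) n
  simp_rw [← h.statMoment_eq hπ hρ] at h1
  simp_rw [← h.palmMoment_eq hρ] at h2
  have hτ := (tau_pos Q k (mul_nonneg n.cast_nonneg (Q.muState_nonneg k) :
    0 ≤ (n : ℝ) * Q.muState k)).ne'
  rw [← tauStar] at h1
  rw [← tau] at h2
  simp only [R, E, Matrix.diagonal_pow, Matrix.mulVec_diagonal, Finset.sum_apply, Pi.smul_apply,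
    Pi.sub_apply, Pi.pow_apply, smul_eq_mul, Pi.zero_apply, statVec, palmVec, mul_sub,
    Finset.sum_sub_distrib]
  rw [h1]
  have h3 : ∀ j, (-1 : ℝ) ^ j * (n.choose j : ℝ) * (Q.rho k ^ (n - j) *
      (Q.tauStar k (n * Q.muState k) / Q.tau k (n * Q.muState k) *
        (palmMoment Q ℙ₀ X T j k).toReal)) =
      Q.tauStar k (n * Q.muState k) / Q.tau k (n * Q.muState k) *
      ((-1 : ℝ) ^ j * (n.choose j : ℝ) * (Q.rho k ^ (n - j) *
        (palmMoment Q ℙ₀ X T j k).toReal)) := fun j => by ring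
  simp_rw [h3]
  rw [← Finset.mul_sum, h2, ← mul_assoc, div_mul_cancel₀ _ hτ, sub_self]

theorem recursion (h : Q.IsPalmEnvironment π ℙ₀ X T) (hπ : Q.IsStationary π)
    (hρ : ∀ k, Q.beta k = 0 → Q.lam k = 0) (n : ℕ) :
    statVec Q ℙ₀ X T n = Matrix.mulVec (Q.E n) (palmVec Q ℙ₀ X T n) +
      ∑ j ∈ Finset.range n, ((-1 : ℝ) ^ (n - 1 - j) * (n.choose j : ℝ)) •
        Matrix.mulVec (Q.R ^ (n - j))
          (statVec Q ℙ₀ X T j - Matrix.mulVec (Q.E n) (palmVec Q ℙ₀ X T j)) := by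
  have key := h.implicit_relation hπ hρ n
  rw [Finset.sum_range_succ, Nat.sub_self, pow_zero, Matrix.one_mulVec, Nat.choose_self,
    Nat.cast_one, mul_one] at key
  -- The term `j = n` carries the sign `(-1)^n`; multiplying by `(-1)^n` isolates it.
  have hsign : ((-1 : ℝ) ^ n) * (-1) ^ n = 1 := by rw [← mul_pow]; simp
  have h2 := congrArg (fun v => ((-1 : ℝ) ^ n) • v) key
  simp only [smul_add, smul_smul, hsign, one_smul, smul_zero, Finset.smul_sum] at h2
  rw [← sub_eq_iff_eq_add', eq_neg_of_add_eq_zero_right h2, ← Finset.sum_neg_distrib]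
  refine Finset.sum_congr rfl fun j hj => ?_
  rw [← neg_smul]
  congr 1
  have hj' := Finset.mem_range.1 hj
  obtain ⟨m, rfl⟩ : ∃ m, n = m + j + 1 := ⟨n - 1 - j, by lia⟩
  have hj2 : ((-1 : ℝ) ^ j) * (-1) ^ j = 1 := by rw [← mul_pow]; simp
  -- The signs match because `(-1)^n (-1)^j = -(-1)^(n-1-j)` for `j < n`.
  rw [show m + j + 1 - 1 - j = m by lia, pow_succ, pow_add]
  linear_combination ((-1 : ℝ) ^ m * ((m + j + 1).choose j : ℝ)) * hj2

theorem totalMoment_ne_top (h : Q.IsPalmEnvironment π ℙ₀ X T) (hπ : Q.IsStationary π)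
    (hρ : ∀ k, Q.beta k = 0 → Q.lam k = 0) (n : ℕ) : totalMoment Q ℙ₀ X T n ≠ ∞ := by
  rw [h.totalMoment_eq hπ hρ]
  exact ENNReal.sum_ne_top.2 fun k _ =>
    ENNReal.mul_ne_top ENNReal.ofReal_ne_top (h.statMoment_ne_top hπ hρ n k)

theorem toReal_totalMoment (h : Q.IsPalmEnvironment π ℙ₀ X T) (hπ : Q.IsStationary π)
    (hρ : ∀ k, Q.beta k = 0 → Q.lam k = 0) (n : ℕ) :
    (totalMoment Q ℙ₀ X T n).toReal = statVec Q ℙ₀ X T n ⬝ᵥ Q.timeDist π := by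
  rw [h.totalMoment_eq hπ hρ, ENNReal.toReal_sum fun k _ =>
    ENNReal.mul_ne_top ENNReal.ofReal_ne_top (h.statMoment_ne_top hπ hρ n k), dotProduct]
  refine Finset.sum_congr rfl fun k _ => ?_
  rw [ENNReal.toReal_mul, ENNReal.toReal_ofReal, mul_comm, statVec]
  exact div_nonneg (mul_nonneg (hπ.nonneg k) (Q.meanSojourn_pos k).le) hπ.sum_pos.le

end IsPalmEnvironment

end Queue

open Filter Topology

/-! ### The exponential `x ↦ exp (-x)` on `[0, ∞]` -/

/-- `exp (-x)` for `x ∈ [0, ∞]`. -/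
def negExp (x : ℝ≥0∞) : ℝ≥0∞ := EReal.exp (-(x : EReal))

theorem continuous_negExp : Continuous negExp :=
  ENNReal.continuous_exp.comp (continuous_neg.comp continuous_coe_ennreal_ereal)

theorem measurable_negExp : Measurable negExp := continuous_negExp.measurable

@[simp] theorem negExp_zero : negExp 0 = 1 := by simp [negExp]

@[simp] theorem negExp_top : negExp ∞ = 0 := by simp [negExp]

theorem negExp_add (x y : ℝ≥0∞) : negExp (x + y) = negExp x * negExp y := by
  rw [negExp, EReal.coe_ennreal_add, EReal.neg_add (by simp) (by simp), sub_eq_add_neg,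
    EReal.exp_add, negExp, negExp]

theorem negExp_sum {ι : Type*} (s : Finset ι) (f : ι → ℝ≥0∞) :
    negExp (∑ i ∈ s, f i) = ∏ i ∈ s, negExp (f i) := by
  classical
  induction s using Finset.induction_on with
  | empty => simp
  | insert i s hi ih => rw [Finset.sum_insert hi, Finset.prod_insert hi, negExp_add, ih]

theorem negExp_anti : Antitone negExp := fun _ _ h =>
  EReal.exp_monotone (EReal.neg_le_neg_iff.2 (EReal.coe_ennreal_le_coe_ennreal_iff.2 h))

theorem negExp_le_one (x : ℝ≥0∞) : negExp x ≤ 1 := by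
  rw [← negExp_zero]; exact negExp_anti zero_le

theorem negExp_ne_top (x : ℝ≥0∞) : negExp x ≠ ∞ :=
  ((negExp_le_one x).trans_lt ENNReal.one_lt_top).ne

theorem negExp_ofReal {x : ℝ} (hx : 0 ≤ x) :
    negExp (ENNReal.ofReal x) = ENNReal.ofReal (Real.exp (-x)) := by
  rw [negExp, EReal.coe_ennreal_ofReal, max_eq_left hx, ← EReal.coe_neg, EReal.exp_coe]

theorem negExp_mul_nat (a : ℝ≥0∞) (n : ℕ) : negExp (a * n) = negExp a ^ n := by
  induction n with
  | zero => simp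
  | succ n ih => rw [Nat.cast_succ, mul_add, mul_one, negExp_add, ih, pow_succ]

/-- The inverse of `negExp` on `[0, 1]`. -/
def negLog (y : ℝ≥0∞) : ℝ≥0∞ := (-(ENNReal.log y)).toENNReal

theorem measurable_negLog : Measurable negLog :=
  (continuous_neg.measurable.comp ENNReal.measurable_log).ereal_toENNReal

theorem negExp_negLog {y : ℝ≥0∞} (hy : y ≤ 1) : negExp (negLog y) = y := by
  have h : 0 ≤ -(ENNReal.log y) := by
    rw [EReal.le_neg, neg_zero, ← ENNReal.log_one]
    exact ENNReal.log_monotone hy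
  rw [negExp, negLog, EReal.coe_toENNReal h, neg_neg, ENNReal.exp_log]

/-! ### Integer-valued random variables -/

/-- Values of `Z` outside `ℕ` are allowed where `g` vanishes. With `g x = exp(-a x)` this covers `Z
= ∞`, so the lemma applies to the number of customers before its finiteness is known. -/
theorem lintegral_comp_eq_tsum {C : Type*} [MeasurableSpace C] {L : Measure C} {Z : C → ℝ≥0∞}
    (hZ : Measurable Z) {g : ℝ≥0∞ → ℝ≥0∞}
    (hg : ∀ᵐ c ∂L, (∃ n : ℕ, Z c = n) ∨ g (Z c) = 0) :
    ∫⁻ c, g (Z c) ∂L = ∑' n : ℕ, g n * L {c | Z c = n} := by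
  have hm : ∀ n : ℕ, MeasurableSet {c | Z c = n} := fun n => hZ (measurableSet_singleton _)
  have : ∀ᵐ c ∂L, g (Z c) = ∑' n : ℕ, {c | Z c = n}.indicator (fun _ => g n) c := by
    filter_upwards [hg] with c hc
    by_cases h : ∃ n : ℕ, Z c = n
    · obtain ⟨n, hn⟩ := h
      rw [tsum_eq_single n]
      · rw [Set.indicator_of_mem (by exact hn), hn]
      · intro m hm
        refine Set.indicator_of_notMem (fun h' => hm ?_) _
        have h'' : Z c = m := h'
        exact_mod_cast h''.symm.trans hn
    · have h0 : g (Z c) = 0 := hc.resolve_left h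
      rw [h0, eq_comm, ENNReal.tsum_eq_zero]
      exact fun n => Set.indicator_of_notMem (fun h' => h ⟨n, h'⟩) _
  rw [lintegral_congr_ae this,
    lintegral_tsum fun n => (measurable_const.indicator (hm n)).aemeasurable]
  simp_rw [lintegral_indicator_const (hm _)]

theorem ae_exists_eq_natCast {C : Type*} [MeasurableSpace C] {L : Measure C}
    [IsProbabilityMeasure L] {Z : C → ℝ≥0∞} (hZ : Measurable Z)
    (h : ∑' n : ℕ, L {c | Z c = n} = 1) : ∀ᵐ c ∂L, ∃ n : ℕ, Z c = n := by
  have hm : ∀ n : ℕ, MeasurableSet {c | Z c = n} := fun n => hZ (measurableSet_singleton _)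
  have hu : {c | ∃ n : ℕ, Z c = n} = ⋃ n : ℕ, {c | Z c = n} := by ext; simp
  have hd : Pairwise (Function.onFun Disjoint fun n : ℕ => {c | Z c = n}) := by
    intro i j hij
    refine Set.disjoint_left.2 fun c hi hj => hij ?_
    have hi' : Z c = i := hi
    have hj' : Z c = j := hj
    exact_mod_cast hi'.symm.trans hj'
  refine (mem_ae_iff_prob_eq_one (hu ▸ MeasurableSet.iUnion hm)).2 ?_
  rw [hu, measure_iUnion hd hm, h]

theorem tsum_poissonMeasure (r : NNReal) : ∑' n : ℕ, poissonMeasure r {n} = 1 := by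
  simp_rw [poissonMeasure_singleton]
  rw [← ENNReal.ofReal_tsum_of_nonneg (fun n => by positivity)
    (hasSum_one_poissonMeasure r).summable, (hasSum_one_poissonMeasure r).tsum_eq,
    ENNReal.ofReal_one]

/-- The probability generating function of the Poisson law. -/
theorem tsum_pow_mul_poissonMeasure (a : ℝ≥0∞) (r : NNReal) :
    ∑' n : ℕ, negExp a ^ n * poissonMeasure r {n} = negExp ((1 - negExp a) * r) := by
  obtain ⟨t, ht⟩ : ∃ t : ℝ, negExp a = ENNReal.ofReal t ∧ 0 ≤ t :=
    ⟨(negExp a).toReal, (ENNReal.ofReal_toReal (negExp_ne_top a)).symm, ENNReal.toReal_nonneg⟩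
  have ht1 : t ≤ 1 := by
    have := negExp_le_one a
    rwa [ht.1, ENNReal.ofReal_le_one] at this
  have hsum : HasSum (fun n : ℕ => t ^ n * (Real.exp (-r) * (r : ℝ) ^ n / n.factorial))
      (Real.exp (-((1 - t) * r))) := by
    have h := (NormedSpace.expSeries_div_hasSum_exp (𝔸 := ℝ) (t * r)).mul_left (Real.exp (-r))
    rw [← Real.exp_eq_exp_ℝ, ← Real.exp_add, show -(r : ℝ) + t * r = -((1 - t) * r) by ring] at h
    refine h.congr_fun ?_
    intro n
    rw [mul_pow]; ring
  have hterm : ∀ n : ℕ, negExp a ^ n * poissonMeasure r {n} =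
      ENNReal.ofReal (t ^ n * (Real.exp (-r) * (r : ℝ) ^ n / n.factorial)) := fun n => by
    rw [poissonMeasure_singleton, ht.1, ENNReal.ofReal_mul (pow_nonneg ht.2 n),
      ENNReal.ofReal_pow ht.2]
  have h1 : (1 - negExp a) * r = ENNReal.ofReal ((1 - t) * r) := by
    rw [ht.1, ENNReal.ofReal_mul (by linarith), ENNReal.ofReal_sub _ ht.2, ENNReal.ofReal_one,
      ENNReal.ofReal_coe_nnreal]
  simp_rw [hterm]
  rw [← ENNReal.ofReal_tsum_of_nonneg (fun n => mul_nonneg (pow_nonneg ht.2 n) (by positivity))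
    hsum.summable, hsum.tsum_eq, h1,
    negExp_ofReal (mul_nonneg (by linarith) r.coe_nonneg)]

/-! ### The Laplace functional of a Poisson process -/

namespace IsPoissonProcess

variable {C α : Type*} [MeasurableSpace C] [MeasurableSpace α] {L : Measure C}
  [IsProbabilityMeasure L] {Φ : C → Measure α} {ν : Measure α}

theorem lintegral_negExp_count (h : IsPoissonProcess L Φ ν) {B : Set α} (hB : MeasurableSet B)
    (hν : ν B ≠ ∞) (a : ℝ≥0∞) :
    ∫⁻ c, negExp (a * Φ c B) ∂L = negExp ((1 - negExp a) * ν B) := by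
  have hlaw := h.law B hB hν
  have hae : ∀ᵐ c ∂L, ∃ n : ℕ, Φ c B = n := by
    refine ae_exists_eq_natCast (h.measurable B hB) ?_
    simp_rw [hlaw]
    exact tsum_poissonMeasure _
  rw [lintegral_comp_eq_tsum (g := fun x => negExp (a * x)) (h.measurable B hB)
    (hae.mono fun c hc => Or.inl hc)]
  simp_rw [hlaw, negExp_mul_nat]
  rw [tsum_pow_mul_poissonMeasure, ENNReal.coe_toNNReal hν]

theorem measurable_measure (h : IsPoissonProcess L Φ ν) : Measurable Φ :=
  Measure.measurable_of_measurable_coe _ h.measurable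

/-- The counts of the level sets are independent because these sets are disjoint, so the transform
factors into the transforms of single Poisson counts. -/
theorem lintegral_negExp_simpleFunc (h : IsPoissonProcess L Φ ν) (f : SimpleFunc α ℝ≥0∞)
    (hf : ν {x | f x ≠ 0} ≠ ∞) :
    ∫⁻ c, negExp (f.lintegral (Φ c)) ∂L =
      negExp ((f.map fun x => 1 - negExp x).lintegral ν) := by
  classical
  -- The value `0` contributes nothing, and its level set may have infinite intensity, where the law
  -- of the count is not prescribed.
  set s := f.range.erase 0 with hs
  have hsum : ∀ (κ : Measure α) (g : ℝ≥0∞ → ℝ≥0∞), g 0 = 0 →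
      (f.map g).lintegral κ = ∑ i : Fin s.card,
        g (s.equivFin.symm i) * κ (f ⁻¹' {(s.equivFin.symm i : ℝ≥0∞)}) := by
    intro κ g hg
    rw [SimpleFunc.map_lintegral, ← Finset.sum_erase (a := (0 : ℝ≥0∞)) _ (by rw [hg, zero_mul]),
      ← Finset.sum_coe_sort, ← Equiv.sum_comp s.equivFin.symm]
  have hB : ∀ i : Fin s.card, MeasurableSet (f ⁻¹' {(s.equivFin.symm i : ℝ≥0∞)}) :=
    fun i => f.measurableSet_preimage _
  have hνB : ∀ i : Fin s.card, ν (f ⁻¹' {(s.equivFin.symm i : ℝ≥0∞)}) ≠ ∞ := by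
    intro i
    refine ((measure_mono fun x hx => ?_).trans_lt hf.lt_top).ne
    have hx' : f x = (s.equivFin.symm i : ℝ≥0∞) := hx
    rw [Set.mem_ofPred_eq, hx']
    exact Finset.ne_of_mem_erase (s.equivFin.symm i).2
  have hd : Pairwise (Function.onFun Disjoint fun i : Fin s.card =>
      f ⁻¹' {(s.equivFin.symm i : ℝ≥0∞)}) := by
    intro i j hij
    refine Set.disjoint_left.2 fun x hi hj => hij ?_
    have hi' : f x = (s.equivFin.symm i : ℝ≥0∞) := hi
    have hj' : f x = (s.equivFin.symm j : ℝ≥0∞) := hj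
    exact s.equivFin.symm.injective (Subtype.ext (hi'.symm.trans hj'))
  have hind := (h.indep s.card _ hB hd).comp
    (fun i x => negExp ((s.equivFin.symm i : ℝ≥0∞) * x))
    (fun i => measurable_negExp.comp (measurable_id.const_mul _))
  have hid : f = f.map fun x => x := by ext; rfl
  rw [hsum ν _ (by simp)]
  conv_lhs => rw [hid]
  simp_rw [hsum _ (fun x => x) rfl, negExp_sum]
  refine (lintegral_prod_eq_prod_lintegral_of_indepFun Finset.univ _ hind fun i =>
    measurable_negExp.comp ((h.measurable _ (hB i)).const_mul _)).trans ?_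
  exact Finset.prod_congr rfl fun i _ => h.lintegral_negExp_count (hB i) (hνB i) _

theorem tendsto_lintegral_negExp {F : ℕ → C → ℝ≥0∞} {G : C → ℝ≥0∞}
    (hF : ∀ n, Measurable (F n)) (hlim : ∀ᵐ c ∂L, Tendsto (fun n => F n c) atTop (𝓝 (G c))) :
    Tendsto (fun n => ∫⁻ c, negExp (F n c) ∂L) atTop (𝓝 (∫⁻ c, negExp (G c) ∂L)) := by
  refine tendsto_lintegral_of_dominated_convergence (fun _ => 1)
    (fun n => measurable_negExp.comp (hF n)) (fun n => ae_of_all _ fun c => negExp_le_one _)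
    (by simp) ?_
  filter_upwards [hlim] with c hc
  exact (continuous_negExp.tendsto _).comp hc

/-- The Laplace functional of a Poisson process. -/
theorem lintegral_negExp [SigmaFinite ν] (h : IsPoissonProcess L Φ ν) {f : α → ℝ≥0∞}
    (hf : Measurable f) :
    ∫⁻ c, negExp (∫⁻ x, f x ∂(Φ c)) ∂L = negExp (∫⁻ x, (1 - negExp (f x)) ∂ν) := by
  -- Cutting the simple approximations down to spanning sets gives them supports of finite
  -- intensity, and they still increase to `f`.
  set F : ℕ → SimpleFunc α ℝ≥0∞ := fun n =>
    (SimpleFunc.eapprox f n).restrict (spanningSets ν n) with hF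
  have happ : ∀ n x, F n x = (spanningSets ν n).indicator (SimpleFunc.eapprox f n) x := fun n x =>
    SimpleFunc.restrict_apply _ (measurableSet_spanningSets ν n) x
  have hmono : ∀ x, Monotone fun n => F n x := by
    intro x n m hnm
    simp only [happ]
    by_cases hx : x ∈ spanningSets ν n
    · rw [Set.indicator_of_mem hx, Set.indicator_of_mem (monotone_spanningSets ν hnm hx)]
      exact SimpleFunc.monotone_eapprox f hnm x
    · rw [Set.indicator_of_notMem hx]; exact zero_le
  have hlim : ∀ x, Tendsto (fun n => F n x) atTop (𝓝 (f x)) := by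
    intro x
    have h1 : Tendsto (fun n => SimpleFunc.eapprox f n x) atTop (𝓝 (f x)) := by
      rw [← SimpleFunc.iSup_eapprox_apply hf x]
      exact tendsto_atTop_iSup fun n m hnm => SimpleFunc.monotone_eapprox f hnm x
    refine h1.congr' ?_
    filter_upwards [eventually_ge_atTop (spanningSetsIndex ν x)] with n hn
    rw [happ, Set.indicator_of_mem
      (monotone_spanningSets ν hn (mem_spanningSetsIndex ν x))]
  have hfin : ∀ n, ν {x | F n x ≠ 0} ≠ ∞ := by
    intro n
    refine ((measure_mono fun x hx => ?_).trans_lt (measure_spanningSets_lt_top ν n)).ne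
    by_contra hx'
    exact hx (by rw [happ, Set.indicator_of_notMem hx'])
  have hkey := fun n => h.lintegral_negExp_simpleFunc (F n) (hfin n)
  simp_rw [← SimpleFunc.lintegral_eq_lintegral] at hkey
  refine tendsto_nhds_unique (f := fun n => ∫⁻ c, negExp (∫⁻ x, F n x ∂(Φ c)) ∂L)
    (l := atTop) ?_ ?_
  · refine tendsto_lintegral_negExp
      (fun n => (Measure.measurable_lintegral (F n).measurable).comp h.measurable_measure)
      (ae_of_all _ fun c => ?_)
    exact lintegral_tendsto_of_tendsto_of_monotone (fun n => (F n).measurable.aemeasurable)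
      (ae_of_all _ hmono) (ae_of_all _ hlim)
  · simp_rw [hkey]
    refine (continuous_negExp.tendsto _).comp ?_
    refine lintegral_tendsto_of_tendsto_of_monotone
      (fun n => ((F n).map _).measurable.aemeasurable) (ae_of_all _ fun x n m hnm => ?_)
      (ae_of_all _ fun x => ?_)
    · exact tsub_le_tsub_left (negExp_anti (hmono x hnm)) 1
    · exact ENNReal.Tendsto.sub tendsto_const_nhds ((continuous_negExp.tendsto _).comp (hlim x))
        (Or.inl ENNReal.one_ne_top)

end IsPoissonProcess

/-! ### Uniqueness of generating functions and moments of the Poisson law -/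

/-- Let `d = f - g`. If `d` vanishes below `n`, dividing the zero series by `t ^ n` bounds `|d n|`
by `t / (1 - t)`, which tends to `0` with `t`. -/
theorem eq_of_tsum_mul_pow_eq {f g : ℕ → ℝ} (hf : ∀ n, f n ∈ Set.Icc (0 : ℝ) 1)
    (hg : ∀ n, g n ∈ Set.Icc (0 : ℝ) 1)
    (h : ∀ t ∈ Set.Ioo (0 : ℝ) 1, ∑' n, t ^ n * f n = ∑' n, t ^ n * g n) : f = g := by
  set d : ℕ → ℝ := fun n => f n - g n with hd
  have hd1 : ∀ n, |d n| ≤ 1 := fun n => abs_le.2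
    ⟨by simp only [hd]; linarith [(hf n).1, (hg n).2],
      by simp only [hd]; linarith [(hf n).2, (hg n).1]⟩
  have hsummable : ∀ {u : ℕ → ℝ}, (∀ n, |u n| ≤ 1) → ∀ t ∈ Set.Ioo (0 : ℝ) 1,
      Summable fun n => t ^ n * u n := by
    intro u hu t ht
    refine Summable.of_norm_bounded (summable_geometric_of_lt_one ht.1.le ht.2) fun n => ?_
    rw [norm_mul, Real.norm_of_nonneg (pow_nonneg ht.1.le n)]
    exact mul_le_of_le_one_right (pow_nonneg ht.1.le n) (hu n)
  have hsum : ∀ t ∈ Set.Ioo (0 : ℝ) 1, ∑' n, t ^ n * d n = 0 := by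
    intro t ht
    have hf' : ∀ n, |f n| ≤ 1 := fun n => by rw [abs_of_nonneg (hf n).1]; exact (hf n).2
    have hg' : ∀ n, |g n| ≤ 1 := fun n => by rw [abs_of_nonneg (hg n).1]; exact (hg n).2
    simp only [hd, mul_sub]
    rw [(hsummable hf' t ht).tsum_sub (hsummable hg' t ht), h t ht, sub_self]
  suffices hzero : ∀ n, d n = 0 from funext fun n => sub_eq_zero.1 (hzero n)
  intro n
  induction n using Nat.strong_induction_on with
  | _ n ih =>
  have hbound : ∀ t ∈ Set.Ioo (0 : ℝ) 1, |d n| ≤ t * (1 - t)⁻¹ := by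
    intro t ht
    have hS := hsummable hd1 t ht
    have h1 := hS.sum_add_tsum_nat_add (n + 1)
    rw [hsum t ht, Finset.sum_range_succ, Finset.sum_eq_zero fun i hi => by
      rw [ih i (Finset.mem_range.1 hi), mul_zero], zero_add] at h1
    have h2 : ∑' i, t ^ (i + (n + 1)) * d (i + (n + 1)) =
        t ^ n * (t * ∑' i, t ^ i * d (i + (n + 1))) := by
      rw [← tsum_mul_left, ← tsum_mul_left]
      exact tsum_congr fun i => by ring
    rw [h2, ← mul_add] at h1
    have h3 : d n = -(t * ∑' i, t ^ i * d (i + (n + 1))) :=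
      eq_neg_of_add_eq_zero_left ((mul_eq_zero.1 h1).resolve_left (pow_pos ht.1 n).ne')
    rw [h3, abs_neg, abs_mul, abs_of_pos ht.1]
    refine mul_le_mul_of_nonneg_left ?_ ht.1.le
    rw [← Real.norm_eq_abs]
    refine tsum_of_norm_bounded (hasSum_geometric_of_lt_one ht.1.le ht.2) fun i => ?_
    rw [norm_mul, Real.norm_of_nonneg (pow_nonneg ht.1.le i)]
    exact mul_le_of_le_one_right (pow_nonneg ht.1.le i) (hd1 _)
  have hlim : Tendsto (fun t : ℝ => t * (1 - t)⁻¹) (𝓝[>] 0) (𝓝 0) := by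
    have : ContinuousAt (fun t : ℝ => t * (1 - t)⁻¹) 0 :=
      continuousAt_id.mul ((continuousAt_const.sub continuousAt_id).inv₀ (by simp))
    have := this.tendsto
    rw [zero_mul] at this
    exact this.mono_left nhdsWithin_le_nhds
  have : |d n| ≤ 0 := ge_of_tendsto hlim
    (Filter.eventually_of_mem (Ioo_mem_nhdsGT one_pos) hbound)
  exact abs_nonpos_iff.1 this

/-- The factorial moments of the Poisson law. -/
theorem tsum_descFactorial_mul_poissonMeasure (r : NNReal) (k : ℕ) :
    ∑' n : ℕ, ((n.descFactorial k : ℕ) : ℝ≥0∞) * poissonMeasure r {n} = (r : ℝ≥0∞) ^ k := by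
  -- The terms with `n < k` vanish; after the shift, `(n + k).descFactorial k / (n + k)! = 1 / n!`
  -- restores the Poisson weights.
  have hshift : ∑' n : ℕ, ((n.descFactorial k : ℕ) : ℝ≥0∞) * poissonMeasure r {n} =
      ∑' n : ℕ, (((n + k).descFactorial k : ℕ) : ℝ≥0∞) * poissonMeasure r {n + k} := by
    refine (Summable.sum_add_tsum_nat_add' (f := fun n : ℕ =>
      ((n.descFactorial k : ℕ) : ℝ≥0∞) * poissonMeasure r {n}) (k := k)
        ENNReal.summable).symm.trans ?_
    rw [Finset.sum_eq_zero fun i hi => by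
      rw [Nat.descFactorial_of_lt (Finset.mem_range.1 hi), Nat.cast_zero, zero_mul], zero_add]
  have hterm : ∀ n : ℕ, (((n + k).descFactorial k : ℕ) : ℝ≥0∞) * poissonMeasure r {n + k} =
      (r : ℝ≥0∞) ^ k * poissonMeasure r {n} := by
    intro n
    rw [poissonMeasure_singleton, poissonMeasure_singleton, ← ENNReal.ofReal_natCast,
      ← ENNReal.ofReal_coe_nnreal, ← ENNReal.ofReal_pow r.coe_nonneg,
      ← ENNReal.ofReal_mul (Nat.cast_nonneg _), ← ENNReal.ofReal_mul (by positivity)]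
    congr 1
    have h1 : (n.factorial : ℝ) * ((n + k).descFactorial k : ℕ) = (n + k).factorial := by
      have := Nat.factorial_mul_descFactorial (Nat.le_add_left k n)
      rw [Nat.add_sub_cancel] at this
      exact_mod_cast this
    rw [← h1]
    have h2 : (((n + k).descFactorial k : ℕ) : ℝ) ≠ 0 := by
      rw [Nat.cast_ne_zero, Ne, Nat.descFactorial_eq_zero_iff_lt]; lia
    have h3 : (n.factorial : ℝ) ≠ 0 := Nat.cast_ne_zero.2 n.factorial_ne_zero
    field_simp
    ring
  rw [hshift]
  simp_rw [hterm]
  rw [ENNReal.tsum_mul_left, tsum_poissonMeasure, mul_one]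

/-! ### The number of customers given the environment, and its average over the environment. -/

namespace Queue

variable {K : ℕ} {Q : Queue K}

/-- The number of customers, as an element of `[0, ∞]`, in terms of the work `w u` done since
time `u`. -/
def countPresent (w : ℝ → ℝ) (c : (ℕ → ℝ) × (ℕ → ℝ)) : ℝ≥0∞ :=
  ∑' n, {n | w (c.1 n) < c.2 n}.indicator (fun _ => 1) n

theorem countPresent_eq (Q : Queue K) (γ : ℝ → Fin K) (c : (ℕ → ℝ) × (ℕ → ℝ)) :
    countPresent (Q.work γ) c = (Q.numCustomers γ c : ℝ≥0∞) := by
  rw [countPresent, ← tsum_subtype, ENNReal.tsum_set_one, numCustomers]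

theorem countPresent_eq_natCast_or_top (w : ℝ → ℝ) (c : (ℕ → ℝ) × (ℕ → ℝ)) :
    (∃ n : ℕ, countPresent w c = n) ∨ countPresent w c = ∞ := by
  rw [countPresent, ← tsum_subtype, ENNReal.tsum_set_one]
  rcases eq_or_ne {n | w (c.1 n) < c.2 n}.encard ⊤ with h | h
  · right; rw [h]; rfl
  · obtain ⟨n, hn⟩ := ENat.ne_top_iff_exists.1 h
    exact Or.inl ⟨n, by rw [← hn]; rfl⟩

theorem measurable_countPresent {β : Type*} [MeasurableSpace β] {w : β → ℝ → ℝ}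
    (hw : Measurable fun p : β × ℝ => w p.1 p.2) :
    Measurable fun p : β × ((ℕ → ℝ) × (ℕ → ℝ)) => countPresent (w p.1) p.2 := by
  refine Measurable.tsum fun n => ?_
  refine Measurable.indicator (s := {p : β × ((ℕ → ℝ) × (ℕ → ℝ)) | w p.1 (p.2.1 n) < p.2.2 n})
    (f := fun _ => (1 : ℝ≥0∞)) measurable_const (measurableSet_lt ?_ ?_)
  · exact hw.comp (measurable_fst.prodMk
      ((measurable_pi_apply n).comp (measurable_fst.comp measurable_snd)))
  · exact (measurable_pi_apply n).comp (measurable_snd.comp measurable_snd)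

theorem measurable_countPresent_const {w : ℝ → ℝ} (hw : Measurable w) :
    Measurable (countPresent w) :=
  (measurable_countPresent (β := Unit) (w := fun _ => w) (hw.comp measurable_snd)).comp
    (measurable_prodMk_left (x := ()))

/-- The expectation of `exp (-a)` or `1` according to whether the service request exceeds `x`
or not. -/
def markTransform (Q : Queue K) (a : ℝ≥0∞) (x : ℝ) : ℝ≥0∞ :=
  ∫⁻ σ, negExp (a * (Set.Ioi x).indicator (fun _ => 1) σ) ∂(expMeasure Q.mu)

theorem markTransform_eq (Q : Queue K) (a : ℝ≥0∞) (x : ℝ) : Q.markTransform a x =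
    negExp a * expMeasure Q.mu (Set.Ioi x) + expMeasure Q.mu (Set.Iic x) := by
  have : ∀ σ, negExp (a * (Set.Ioi x).indicator (fun _ => 1) σ) =
      (Set.Ioi x).indicator (fun _ => negExp a) σ + (Set.Iic x).indicator (fun _ => 1) σ := by
    intro σ
    rcases lt_or_ge x σ with h | h
    · simp [Set.indicator, h, h.not_ge]
    · simp [Set.indicator, h, h.not_gt]
  rw [markTransform]
  simp_rw [this]
  rw [lintegral_add_left (measurable_const.indicator measurableSet_Ioi),
    lintegral_indicator_const measurableSet_Ioi, lintegral_indicator_const measurableSet_Iic,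
    one_mul]

theorem markTransform_add (Q : Queue K) (a : ℝ≥0∞) (x : ℝ) :
    Q.markTransform a x + (1 - negExp a) * expMeasure Q.mu (Set.Ioi x) = 1 := by
  have := isProbabilityMeasure_expMeasure Q.mu_pos
  rw [markTransform_eq, add_right_comm, ← add_mul, add_tsub_cancel_of_le (negExp_le_one a),
    one_mul, ← Set.compl_Iic, add_comm, measure_add_measure_compl measurableSet_Iic, measure_univ]

theorem markTransform_le_one (Q : Queue K) (a : ℝ≥0∞) (x : ℝ) : Q.markTransform a x ≤ 1 := by
  rw [← Q.markTransform_add a x]; exact le_self_add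

/-- This is the integrand that the Laplace functional of the arrivals produces; with `x = F_γ(u)`
its integral against the arrival intensity is `(1 - e^{-a}) |A_γ|`. -/
theorem one_sub_markTransform (Q : Queue K) (a : ℝ≥0∞) (x : ℝ) :
    1 - Q.markTransform a x = (1 - negExp a) * expMeasure Q.mu (Set.Ioi x) :=
  ENNReal.sub_eq_of_eq_add_rev ((Q.markTransform_le_one a x).trans_lt ENNReal.one_lt_top).ne
    (Q.markTransform_add a x).symm

theorem measurable_markTransform (Q : Queue K) (a : ℝ≥0∞) : Measurable (Q.markTransform a) := by
  simp_rw [funext (Q.markTransform_eq a)]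
  have h1 : Measurable fun x => expMeasure Q.mu (Set.Ioi x) :=
    Antitone.measurable fun _ _ h => measure_mono (Set.Ioi_subset_Ioi h)
  have h2 : Measurable fun x => expMeasure Q.mu (Set.Iic x) :=
    Monotone.measurable fun _ _ h => measure_mono (Set.Iic_subset_Iic.2 h)
  exact (h1.const_mul _).add h2

namespace IsCustomerLaw

variable {γ : ℝ → Fin K} {L : Measure ((ℕ → ℝ) × (ℕ → ℝ))} [IsProbabilityMeasure L]

/-- The service requests being averaged out, with the arrival times fixed. -/
theorem lintegral_negExp_services (h : Q.IsCustomerLaw γ L) (w : ℝ → ℝ) (a : ℝ≥0∞) (u : ℕ → ℝ) :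
    ∫⁻ c, negExp (a * countPresent w (u, c.2)) ∂L =
      negExp (∑' n, negLog (Q.markTransform a (w (u n)))) := by
  have hsnd : ∀ n, Measurable fun c : (ℕ → ℝ) × (ℕ → ℝ) => c.2 n := fun n =>
    (measurable_pi_apply n).comp measurable_snd
  have hmark : ∀ x, Measurable fun σ : ℝ => a * (Set.Ioi x).indicator (fun _ => 1) σ := fun x =>
    (measurable_const.indicator measurableSet_Ioi).const_mul a
  have hind := h.service_indep.comp
    (fun n σ => negExp (a * (Set.Ioi (w (u n))).indicator (fun _ => 1) σ))
    (fun n => measurable_negExp.comp (hmark _))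
  have hfin : ∀ m : ℕ, ∫⁻ c, negExp (∑ n ∈ Finset.range m,
      a * (Set.Ioi (w (u n))).indicator (fun _ => 1) (c.2 n)) ∂L =
      negExp (∑ n ∈ Finset.range m, negLog (Q.markTransform a (w (u n)))) := by
    intro m
    simp_rw [negExp_sum]
    refine (lintegral_prod_eq_prod_lintegral_of_indepFun (Finset.range m) _ hind fun n =>
      measurable_negExp.comp ((hmark _).comp (hsnd n))).trans ?_
    refine Finset.prod_congr rfl fun n _ => ?_
    rw [negExp_negLog (Q.markTransform_le_one _ _), markTransform, ← h.service_law n]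
    exact (lintegral_map (measurable_negExp.comp (hmark (w (u n)))) (hsnd n)).symm
  refine tendsto_nhds_unique (f := fun m : ℕ => ∫⁻ c, negExp (∑ n ∈ Finset.range m,
      a * (Set.Ioi (w (u n))).indicator (fun _ => 1) (c.2 n)) ∂L) (l := atTop) ?_ ?_
  · refine IsPoissonProcess.tendsto_lintegral_negExp
      (fun m => Finset.measurable_fun_sum _ fun n _ => (hmark _).comp (hsnd n))
      (ae_of_all _ fun c => ?_)
    rw [countPresent, ← ENNReal.tsum_mul_left]
    exact ENNReal.tendsto_nat_tsum _
  · simp_rw [hfin]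
    exact (continuous_negExp.tendsto _).comp (ENNReal.tendsto_nat_tsum _)

/-- The Laplace transform of the number of customers is that of a Poisson law. -/
theorem lintegral_negExp_countPresent (h : Q.IsCustomerLaw γ L) (hγ : Measurable γ) (a : ℝ≥0∞) :
    ∫⁻ c, negExp (a * countPresent (Q.work γ) c) ∂L = negExp ((1 - negExp a) * Q.area γ) := by
  have hw := (Q.continuous_work hγ).measurable
  have hf : Measurable fun x => negLog (Q.markTransform a (Q.work γ x)) :=
    measurable_negLog.comp ((Q.measurable_markTransform a).comp hw)
  have hcount : Measurable (countPresent (Q.work γ)) :=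
    measurable_countPresent_const hw
  have hmeas : Measurable fun c => negExp (a * countPresent (Q.work γ) c) :=
    measurable_negExp.comp (hcount.const_mul a)
  -- Arrivals and service requests are independent, so `L` is the product of its marginals and the
  -- services can be integrated with the arrivals fixed. Using `negLog`, the outcome becomes a
  -- Laplace functional with test function `hf`.
  have hprod := h.indep.map_prod_eq_prod_map_map measurable_fst.aemeasurable
    measurable_snd.aemeasurable
  have hid : L.map (fun c => (c.1, c.2)) = L := Measure.map_id
  have := Measure.isProbabilityMeasure_map (μ := L)
    (measurable_snd : Measurable (Prod.snd : (ℕ → ℝ) × (ℕ → ℝ) → _)).aemeasurable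
  rw [hid] at hprod
  have hinner : ∀ u : ℕ → ℝ, ∫⁻ s, negExp (a * countPresent (Q.work γ) (u, s)) ∂(L.map Prod.snd) =
      negExp (∑' n, negLog (Q.markTransform a (Q.work γ (u n)))) := fun u => by
    rw [← h.lintegral_negExp_services (Q.work γ) a u]
    exact lintegral_map (hmeas.comp measurable_prodMk_left) measurable_snd
  have houter : Measurable fun u : ℕ → ℝ =>
      negExp (∑' n, negLog (Q.markTransform a (Q.work γ (u n)))) :=
    measurable_negExp.comp (Measurable.tsum fun n => hf.comp (measurable_pi_apply n))
  conv_lhs => rw [hprod]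
  rw [lintegral_prod _ hmeas.aemeasurable]
  simp_rw [hinner]
  rw [lintegral_map houter measurable_fst]
  have hlap := h.arrivals.lintegral_negExp hf
  simp only [lintegral_sum_measure, lintegral_dirac, negExp_negLog (Q.markTransform_le_one _ _),
    one_sub_markTransform] at hlap
  rw [hlap]
  congr 1
  have hIoi : Measurable fun u => expMeasure Q.mu (Set.Ioi (Q.work γ u)) := by
    refine Measurable.comp (g := fun x => expMeasure Q.mu (Set.Ioi x)) ?_ hw
    exact Antitone.measurable fun _ _ h => measure_mono (Set.Ioi_subset_Ioi h)
  rw [lintegral_const_mul _ hIoi, Q.area_eq_lintegral hγ,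
    lintegral_withDensity_eq_lintegral_mul _ (Q.measurable_lam hγ) hIoi]
  congr 1
  refine setLIntegral_congr_fun measurableSet_Iio fun u hu => ?_
  rw [Pi.mul_apply, expMeasure_Ioi Q.mu_pos (Q.work_nonneg (le_of_lt hu))]

/-- The number of customers has a Poisson law with mean `|A_γ|`. -/
theorem measure_countPresent_eq (h : Q.IsCustomerLaw γ L) (hγ : Measurable γ)
    (hA : Q.area γ ≠ ∞) (n : ℕ) :
    L {c | countPresent (Q.work γ) c = n} = poissonMeasure (Q.area γ).toNNReal {n} := by
  have hw := (Q.continuous_work hγ).measurable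
  have hcount : Measurable (countPresent (Q.work γ)) :=
    measurable_countPresent_const hw
  have hIcc : ∀ {x : ℝ≥0∞}, x ≤ 1 → x.toReal ∈ Set.Icc (0 : ℝ) 1 := fun hx =>
    ⟨ENNReal.toReal_nonneg, by simpa using ENNReal.toReal_mono ENNReal.one_ne_top hx⟩
  have hpois : ∀ n : ℕ, poissonMeasure (Q.area γ).toNNReal {n} ≤ 1 := fun n =>
    (ENNReal.le_tsum n).trans (tsum_poissonMeasure _).le
  have key : (fun n : ℕ => (L {c | countPresent (Q.work γ) c = n}).toReal) =
      fun n : ℕ => (poissonMeasure (Q.area γ).toNNReal {n}).toReal := by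
    refine eq_of_tsum_mul_pow_eq (fun n => hIcc prob_le_one) (fun n => hIcc (hpois n))
      fun t ht => ?_
    have hlog : 0 < -Real.log t := neg_pos.2 (Real.log_neg ht.1 ht.2)
    set a := ENNReal.ofReal (-Real.log t) with ha
    have ha0 : a ≠ 0 := by simpa [ha] using hlog
    have hneg : negExp a = ENNReal.ofReal t := by
      rw [ha, negExp_ofReal hlog.le, neg_neg, Real.exp_log ht.1]
    have h1 := h.lintegral_negExp_countPresent hγ a
    -- Since `a = -log t` is not `0`, an infinite count contributes `exp(-∞) = 0`. Equality of the
    -- generating functions on `(0, 1)` then identifies all the masses.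
    rw [lintegral_comp_eq_tsum (g := fun x => negExp (a * x)) hcount
      (ae_of_all _ fun c => (countPresent_eq_natCast_or_top _ c).imp_right fun hc => by
        rw [hc, ENNReal.mul_top ha0, negExp_top]),
      ← ENNReal.coe_toNNReal hA, ← tsum_pow_mul_poissonMeasure] at h1
    simp only [negExp_mul_nat, hneg] at h1
    have h2 := congrArg ENNReal.toReal h1
    have hne : ∀ {x : ℝ≥0∞} (n : ℕ), x ≤ 1 → ENNReal.ofReal t ^ n * x ≠ ∞ := fun n hx =>
      ENNReal.mul_ne_top (ENNReal.pow_ne_top ENNReal.ofReal_ne_top)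
        (hx.trans_lt ENNReal.one_lt_top).ne
    rw [ENNReal.tsum_toReal_eq fun n => hne n prob_le_one,
      ENNReal.tsum_toReal_eq fun n => hne n (hpois n)] at h2
    simpa only [ENNReal.toReal_mul, ENNReal.toReal_pow, ENNReal.toReal_ofReal ht.1.le] using h2
  exact (ENNReal.toReal_eq_toReal_iff' (measure_ne_top _ _)
    ((hpois n).trans_lt ENNReal.one_lt_top).ne).1 (congrFun key n)

theorem ae_countPresent (h : Q.IsCustomerLaw γ L) (hγ : Measurable γ) (hA : Q.area γ ≠ ∞) :
    ∀ᵐ c ∂L, ∃ n : ℕ, countPresent (Q.work γ) c = n := by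
  refine ae_exists_eq_natCast ?_ ?_
  · exact measurable_countPresent_const (Q.continuous_work hγ).measurable
  · simp_rw [h.measure_countPresent_eq hγ hA]
    exact tsum_poissonMeasure _

/-- The floor of `toReal` is a measurable way of reading off the natural number to which the count
is almost surely equal. -/
theorem lintegral_descFactorial (h : Q.IsCustomerLaw γ L) (hγ : Measurable γ)
    (hA : Q.area γ ≠ ∞) (k : ℕ) :
    ∫⁻ c, ((⌊(countPresent (Q.work γ) c).toReal⌋₊.descFactorial k : ℕ) : ℝ≥0∞) ∂L =
      Q.area γ ^ k := by
  have hcount : Measurable (countPresent (Q.work γ)) :=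
    measurable_countPresent_const (Q.continuous_work hγ).measurable
  rw [lintegral_comp_eq_tsum (g := fun x => ((⌊x.toReal⌋₊.descFactorial k : ℕ) : ℝ≥0∞)) hcount
    ((h.ae_countPresent hγ hA).mono fun c hc => Or.inl hc)]
  simp_rw [h.measure_countPresent_eq hγ hA, ENNReal.toReal_natCast, Nat.floor_natCast]
  rw [tsum_descFactorial_mul_poissonMeasure, ENNReal.coe_toNNReal hA]

end IsCustomerLaw

theorem floor_toReal_countPresent (Q : Queue K) (γ : ℝ → Fin K) (c : (ℕ → ℝ) × (ℕ → ℝ)) :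
    ⌊(countPresent (Q.work γ) c).toReal⌋₊ = (Q.numCustomers γ c).toNat := by
  rw [countPresent_eq]
  generalize Q.numCustomers γ c = N
  cases N <;> simp

variable [NeZero K] {π : Fin K → ℝ} {Ω : Type*} [MeasurableSpace Ω] {ℙ₀ : Measure Ω}
  [IsProbabilityMeasure ℙ₀] {X : ℤ → Ω → Fin K} {T : ℤ → Ω → ℝ}

namespace IsPalmEnvironment

theorem customers (h : Q.IsPalmEnvironment π ℙ₀ X T) (hπ : Q.IsStationary π)
    (hρ : ∀ k, Q.beta k = 0 → Q.lam k = 0) (κ : Kernel (Ω × ℝ) ((ℕ → ℝ) × (ℕ → ℝ)))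
    [IsMarkovKernel κ]
    (hκ : ∀ᵐ z ∂(stationaryLaw ℙ₀ T), Q.IsCustomerLaw (statPath X T z) (κ z)) :
    (∀ᵐ p ∂((stationaryLaw ℙ₀ T).compProd κ),
      Q.numCustomers (statPath X T p.1) p.2 ≠ ⊤) ∧
    ∀ n : ℕ, ∫⁻ p, (((Q.numCustomers (statPath X T p.1) p.2).toNat.descFactorial n : ℕ) :
      ℝ≥0∞) ∂((stationaryLaw ℙ₀ T).compProd κ) = totalMoment Q ℙ₀ X T n := by
  have := h.isProbabilityMeasure_stationaryLaw hπ
  -- This version of the stationary path is jointly measurable without exceptional set and agrees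
  -- almost surely with `statPath`, so the integrals over the environment can be disintegrated.
  set γ : Ω × ℝ → ℝ → Fin K := fun z t => regularPath X T z.1 (t + z.2) with hγdef
  have hγ : Measurable fun p : (Ω × ℝ) × ℝ => γ p.1 p.2 :=
    (measurable_regularPath h.measurable_X h.measurable_T).comp
      (measurable_fst.fst.prodMk (measurable_snd.add measurable_fst.snd))
  have hγz : ∀ z, Measurable (γ z) := fun z => hγ.comp measurable_prodMk_left
  have hA : ∀ z, Q.area (γ z) ≠ ∞ := fun z =>
    ((Q.area_le hρ (hγz z)).trans_lt ENNReal.ofReal_lt_top).ne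
  have hcount : Measurable fun p : (Ω × ℝ) × ((ℕ → ℝ) × (ℕ → ℝ)) =>
      countPresent (Q.work (γ p.1)) p.2 :=
    measurable_countPresent (w := fun z => Q.work (γ z)) (Q.measurable_work_uncurry hγ)
  have hae : ∀ᵐ z ∂(stationaryLaw ℙ₀ T), statPath X T z = γ z :=
    h.ae_stationaryLaw.mono fun z hz => by
      ext t; simp only [hγdef, statPath, regularPath_eq hz.1]
  have hfst : ((stationaryLaw ℙ₀ T).compProd κ).map Prod.fst = stationaryLaw ℙ₀ T :=
    Measure.fst_compProd _ _
  have haeprod : ∀ᵐ p ∂((stationaryLaw ℙ₀ T).compProd κ), statPath X T p.1 = γ p.1 :=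
    ae_of_ae_map measurable_fst.aemeasurable (hfst ▸ hae)
  constructor
  · have hm : MeasurableSet {p : (Ω × ℝ) × ((ℕ → ℝ) × (ℕ → ℝ)) |
        countPresent (Q.work (γ p.1)) p.2 ≠ ∞} := hcount (measurableSet_singleton ∞).compl
    have hfin : ∀ᵐ p ∂((stationaryLaw ℙ₀ T).compProd κ),
        countPresent (Q.work (γ p.1)) p.2 ≠ ∞ := by
      refine Measure.ae_compProd_of_ae_ae hm ?_
      filter_upwards [hae, hκ] with z hz hzκ
      rw [hz] at hzκ
      filter_upwards [hzκ.ae_countPresent (hγz z) (hA z)] with c ⟨n, hn⟩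
      rw [hn]; exact ENNReal.natCast_ne_top n
    filter_upwards [hfin, haeprod] with p hp hpγ
    rw [hpγ]
    intro htop
    rw [countPresent_eq, htop] at hp
    exact hp rfl
  · intro n
    have hm : Measurable fun p : (Ω × ℝ) × ((ℕ → ℝ) × (ℕ → ℝ)) =>
        ((⌊(countPresent (Q.work (γ p.1)) p.2).toReal⌋₊.descFactorial n : ℕ) : ℝ≥0∞) :=
      (measurable_of_countable fun m : ℕ => ((m.descFactorial n : ℕ) : ℝ≥0∞)).comp
        (Nat.measurable_floor.comp hcount.ennreal_toReal)
    rw [lintegral_congr_ae (g := fun p =>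
      ((⌊(countPresent (Q.work (γ p.1)) p.2).toReal⌋₊.descFactorial n : ℕ) : ℝ≥0∞))
      (haeprod.mono fun p hp => by
        simp only [floor_toReal_countPresent, hp]), Measure.lintegral_compProd hm, totalMoment]
    refine lintegral_congr_ae ?_
    filter_upwards [hae, hκ] with z hz hzκ
    rw [hz] at hzκ
    rw [hz, hzκ.lintegral_descFactorial (hγz z) (hA z)]

end IsPalmEnvironment

end Queue

end MMInf

end

theorem mainTheorem2 {K : ℕ} [NeZero K] (Q : MMInf.Queue K) (π : Fin K → ℝ)
    (hπ : Q.IsStationary π) (hρ : ∀ k, Q.beta k = 0 → Q.lam k = 0)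
    {Ω : Type*} [MeasurableSpace Ω] (ℙ₀ : Measure Ω) [IsProbabilityMeasure ℙ₀]
    (X : ℤ → Ω → Fin K) (T : ℤ → Ω → ℝ) (hXT : Q.IsPalmEnvironment π ℙ₀ X T) :
    -- all moments are finite
    (∀ n k, MMInf.palmMoment Q ℙ₀ X T n k ≠ ∞ ∧ MMInf.statMoment Q ℙ₀ X T n k ≠ ∞) ∧
    -- the implicit relation
    (∀ n : ℕ, ∑ j ∈ Finset.range (n + 1), ((-1 : ℝ) ^ j * (n.choose j : ℝ)) •
      Matrix.mulVec (Q.R ^ (n - j))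
        (MMInf.statVec Q ℙ₀ X T j - Matrix.mulVec (Q.E n) (MMInf.palmVec Q ℙ₀ X T j)) = 0) ∧
    -- the recursive formula
    (∀ n : ℕ, MMInf.statVec Q ℙ₀ X T n =
      Matrix.mulVec (Q.E n) (MMInf.palmVec Q ℙ₀ X T n) +
      ∑ j ∈ Finset.range n, ((-1 : ℝ) ^ (n - 1 - j) * (n.choose j : ℝ)) •
        Matrix.mulVec (Q.R ^ (n - j))
          (MMInf.statVec Q ℙ₀ X T j - Matrix.mulVec (Q.E n) (MMInf.palmVec Q ℙ₀ X T j))) ∧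
    -- the moments of `|A_Γ|`
    (∀ n : ℕ, MMInf.totalMoment Q ℙ₀ X T n ≠ ∞ ∧
      (MMInf.totalMoment Q ℙ₀ X T n).toReal = MMInf.statVec Q ℙ₀ X T n ⬝ᵥ Q.timeDist π) ∧
    -- the factorial moments of the number `N` of customers
    (∀ κ : Kernel (Ω × ℝ) ((ℕ → ℝ) × (ℕ → ℝ)), IsMarkovKernel κ →
      (∀ᵐ z ∂(MMInf.stationaryLaw ℙ₀ T), Q.IsCustomerLaw (MMInf.statPath X T z) (κ z)) →
      (∀ᵐ p ∂((MMInf.stationaryLaw ℙ₀ T).compProd κ),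
        Q.numCustomers (MMInf.statPath X T p.1) p.2 ≠ ⊤) ∧
      ∀ n : ℕ, ∫⁻ p, (((Q.numCustomers (MMInf.statPath X T p.1) p.2).toNat.descFactorial n : ℕ) :
          ℝ≥0∞) ∂((MMInf.stationaryLaw ℙ₀ T).compProd κ) = MMInf.totalMoment Q ℙ₀ X T n) := by
  refine ⟨fun n k => ⟨hXT.palmMoment_ne_top hπ hρ n k, hXT.statMoment_ne_top hπ hρ n k⟩,
    hXT.implicit_relation hπ hρ, hXT.recursion hπ hρ,
    fun n => ⟨hXT.totalMoment_ne_top hπ hρ n, hXT.toReal_totalMoment hπ hρ n⟩,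
    fun κ hκ hlaw => ?_⟩
  exact hXT.customers hπ hρ κ hlaw
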